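/- Let $\mathcal X,\mathcal Y$ be finite non-empty sets and let $W(x,y|x',y')$ be an irreducible and ergodic (aperiodic) transition matrix on $\mathcal X\times\mathcal Y$, so that $\sum_{x,y}W(x,y|x',y')=1$. Call $W$ *non-hidden* if $W(y|y'):=\sum_x W(x,y|x',y')$ does not depend on $x'$ (for all $y,y'$), and *strongly non-hidden* if for every $\theta>-1$ and all $y,y'$ the sum $W_\theta(y|y'):=\sum_x W(x,y|x',y')^{1+\theta}$ does not depend on $x'$. Write $\rho(A)$ for the Perron–Frobenius eigenvalue (spectral radius) of a non-negative matrix $A$; matrix entries below are read as $0$ where $W(x,y|x',y')=0$, respectively $W(y|y')=0$. For non-hidden $W$ and $\theta\in(-1,0)\cup(0,\infty)$ put $$H^{\downarrow,W}_{1+\theta}(X|Y):=-\tfrac1\theta\log\rho\big(W(x,y|x',y')^{1+\theta}W(y|y')^{-\theta}\big),$$ extended to $\theta=0$ and $\theta=-1$ by taking limits, let $H^W(X|Y):=H^{\downarrow,W}_1(X|Y)$, and $$\mathsf V^W(X|Y):=\lim_{\theta\to0}\frac{2\,[H^W(X|Y)-H^{\downarrow,W}_{1+\theta}(X|Y)]}{\theta}.$$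 For strongly non-hidden $W$ put $$H^{\uparrow,W}_{1+\theta}(X|Y):=-\tfrac{1+\theta}{\theta}\log\rho\big(W_\theta(y|y')^{1/(1+\theta)}\big)\qquad(\theta\in(-1,0)\cup(0,\infty)),$$ extended to $\theta=0$ and $\theta=-1$ by taking limits, and, for $\theta,\theta'>-1$, $$H^{W}_{1+\theta,1+\theta'}(X|Y):=-\tfrac1\theta\log\rho\big(W_\theta(y|y')\,W_{\theta'}(y|y')^{-\theta/(1+\theta')}\big)+\tfrac{\theta'}{1+\theta'}H^{\uparrow,W}_{1+\theta'}(X|Y),$$ extended to $\theta=0$ by taking the limit in $\theta$. If $W$ is non-hidden, then the limits defining $H^{\downarrow,W}_1$, $H^{\downarrow,W}_0$ and $\mathsf V^W(X|Y)$ exist, and: 1. $\theta\mapsto\theta H^{\downarrow,W}_{1+\theta}(X|Y)$ is concave on $[-1,\infty)$, and it is strictly concave iff $\mathsf V^W(X|Y)>0$. 2. $\theta\mapsto H^{\downarrow,W}_{1+\theta}(X|Y)$ is non-increasing on $[-1,\infty)$, and it is strictly decreasing iff $\mathsf V^W(X|Y)>0$. If $W$ is strongly non-hidden, then the limits defining $H^{\uparrow,W}_1$,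 $H^{\uparrow,W}_0$ and $H^W_{1,1+\theta'}$ also exist, and: 3. $\theta\mapsto\theta H^{\uparrow,W}_{1+\theta}(X|Y)$ is concave on $[-1,\infty)$, and it is strictly concave iff $\mathsf V^W(X|Y)>0$. 4. $\theta\mapsto H^{\uparrow,W}_{1+\theta}(X|Y)$ is non-increasing on $[-1,\infty)$, and it is strictly decreasing iff $\mathsf V^W(X|Y)>0$. 5. $H^{\downarrow,W}_{1+\theta}(X|Y)\le H^{\uparrow,W}_{1+\theta}(X|Y)$ for every $\theta\in(-1,0)\cup(0,\infty)$. 6. For every fixed $\theta'>-1$, $\theta\mapsto\theta H^{W}_{1+\theta,1+\theta'}(X|Y)$ is concave on $(-1,\infty)$, and it is strictly concave iff $\mathsf V^W(X|Y)>0$. 7. For every fixed $\theta'>-1$, $\theta\mapsto H^{W}_{1+\theta,1+\theta'}(X|Y)$ is non-increasing on $(-1,\infty)$, and it is strictly decreasing iff $\mathsf V^W(X|Y)>0$. 8. $H^{W}_{1+\theta,1}(X|Y)=H^{\downarrow,W}_{1+\theta}(X|Y)$ for every $\theta>-1$. 9. $H^{W}_{1+\theta,1+\theta}(X|Y)=H^{\uparrow,W}_{1+\theta}(X|Y)$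 for every $\theta>-1$. 10. For every $\theta\in(-1,0)\cup(0,\infty)$, the function $\theta'\mapsto H^{W}_{1+\theta,1+\theta'}(X|Y)$ on $(-1,\infty)$ attains its maximum at $\theta'=\theta$, and it is differentiable there with $$\frac{d\,H^{W}_{1+\theta,1+\theta'}(X|Y)}{d\theta'}\bigg|_{\theta'=\theta}=0.$$ -/

import Mathlib

open Set Filter Topology

namespace MarkovRenyi

noncomputable section

/-- The Perron-Frobenius eigenvalue of an entrywise nonnegative matrix: its spectral radius,
that is, the largest modulus of a complex eigenvalue. -/
def pfEigenvalue {n : Type*} [Fintype n] [DecidableEq n] (A : Matrix n n ℝ) : ℝ :=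
  (spectralRadius ℂ (A.map (algebraMap ℝ ℂ))).toReal

/-- Ergodicity of an irreducible transition matrix, i.e. aperiodicity: the possible return times
to any given state have no common divisor other than `1`. -/
def IsErgodic {n : Type*} [Fintype n] [DecidableEq n] (A : Matrix n n ℝ) : Prop :=
  ∀ s : n, ∀ d : ℕ, (∀ k : ℕ, 0 < k → 0 < (A ^ k) s s → d ∣ k) → d = 1

variable {X Y : Type*} [Fintype X] [DecidableEq X] [Fintype Y] [DecidableEq Y]

/- Throughout, the entry `W (x, y) (x', y')` is the probability `W(x, y | x', y')` of going from
`(x', y')` to `(x, y)`; a transition matrix is thus column-stochastic. -/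

/-- `W` is non-hidden with respect to `Y`: `∑ x, W(x, y | x', y')` does not depend on `x'`. -/
def NonHidden (W : Matrix (X × Y) (X × Y) ℝ) : Prop :=
  ∀ (y y' : Y) (x₁ x₂ : X), ∑ x, W (x, y) (x₁, y') = ∑ x, W (x, y) (x₂, y')

/-- `W` is strongly non-hidden with respect to `Y`: for every `θ > -1`,
`∑ x, W(x, y | x', y') ^ (1 + θ)` does not depend on `x'`. -/
def StronglyNonHidden (W : Matrix (X × Y) (X × Y) ℝ) : Prop :=
  ∀ θ : ℝ, -1 < θ → ∀ (y y' : Y) (x₁ x₂ : X),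
    ∑ x, W (x, y) (x₁, y') ^ (1 + θ) = ∑ x, W (x, y) (x₂, y') ^ (1 + θ)

variable [Nonempty X]

/-- `W(y | y')`; for non-hidden `W` the choice of `x'` is irrelevant. -/
def marginal (W : Matrix (X × Y) (X × Y) ℝ) : Matrix Y Y ℝ :=
  Matrix.of fun y y' => ∑ x, W (x, y) (Classical.arbitrary X, y')

/-- `W_θ(y | y')`; for strongly non-hidden `W` and `θ > -1` the choice of `x'` is irrelevant. -/
def powerMarginal (W : Matrix (X × Y) (X × Y) ℝ) (θ : ℝ) : Matrix Y Y ℝ :=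
  Matrix.of fun y y' => ∑ x, W (x, y) (Classical.arbitrary X, y') ^ (1 + θ)

/-- The tilted matrix `W(x, y | x', y') ^ (1 + θ) * W(y | y') ^ (-θ)`. For `θ > -1` its entry
is `0` wherever `W(x, y | x', y') = 0`. -/
def tilted (W : Matrix (X × Y) (X × Y) ℝ) (θ : ℝ) : Matrix (X × Y) (X × Y) ℝ :=
  Matrix.of fun s s' => W s s' ^ (1 + θ) * marginal W s.2 s'.2 ^ (-θ)

/-- `K_θ(y | y') = W_θ(y | y') ^ (1 / (1 + θ))`. -/
def kMatrix (W : Matrix (X × Y) (X × Y) ℝ) (θ : ℝ) : Matrix Y Y ℝ :=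
  Matrix.of fun y y' => powerMarginal W θ y y' ^ (1 / (1 + θ))

/-- `N_{θ,θ'}(y | y') = W_θ(y | y') * W_θ'(y | y') ^ (-θ / (1 + θ'))`. -/
def nMatrix (W : Matrix (X × Y) (X × Y) ℝ) (θ θ' : ℝ) : Matrix Y Y ℝ :=
  Matrix.of fun y y' => powerMarginal W θ y y' * powerMarginal W θ' y y' ^ (-θ / (1 + θ'))

/-- The lower conditional Rényi entropy of order `1 + θ` for `W`, for `θ ≥ -1`;
at `θ = 0` and `θ = -1` it is defined by taking the limit. -/
def lowerEntropy (W : Matrix (X × Y) (X × Y) ℝ) (θ : ℝ) : ℝ :=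
  let f : ℝ → ℝ := fun t => -(1 / t) * Real.log (pfEigenvalue (tilted W t))
  if θ = 0 then limUnder (𝓝[≠] 0) f
  else if θ = -1 then limUnder (𝓝[>] (-1)) f
  else f θ

/-- The conditional entropy for `W`. -/
def condEntropy (W : Matrix (X × Y) (X × Y) ℝ) : ℝ := lowerEntropy W 0

/-- The difference quotient whose limit at `θ → 0` is the conditional variance for `W`. -/
def varianceQuotient (W : Matrix (X × Y) (X × Y) ℝ) (θ : ℝ) : ℝ :=
  2 * (condEntropy W - lowerEntropy W θ) / θ

/-- The conditional variance `V^W(X|Y)` for `W`. -/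
def condVariance (W : Matrix (X × Y) (X × Y) ℝ) : ℝ :=
  limUnder (𝓝[≠] 0) (varianceQuotient W)

/-- The upper conditional Rényi entropy of order `1 + θ` for `W`, for `θ ≥ -1`;
at `θ = 0` and `θ = -1` it is defined by taking the limit. -/
def upperEntropy (W : Matrix (X × Y) (X × Y) ℝ) (θ : ℝ) : ℝ :=
  let f : ℝ → ℝ := fun t => -((1 + t) / t) * Real.log (pfEigenvalue (kMatrix W t))
  if θ = 0 then limUnder (𝓝[≠] 0) f
  else if θ = -1 then limUnder (𝓝[>] (-1)) f
  else f θ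

/-- The two-parameter conditional Rényi entropy of orders `1 + θ`, `1 + θ'` for `W`, for
`θ, θ' > -1`; at `θ = 0` it is defined by taking the limit in `θ`. -/
def twoParamEntropy (W : Matrix (X × Y) (X × Y) ℝ) (θ θ' : ℝ) : ℝ :=
  let f : ℝ → ℝ := fun t =>
    -(1 / t) * Real.log (pfEigenvalue (nMatrix W t θ')) + θ' / (1 + θ') * upperEntropy W θ'
  if θ = 0 then limUnder (𝓝[≠] 0) f else f θ

end

end MarkovRenyi

/-! Up to sign and elementary prefactors, each entropy is the logarithm of a Perron-Frobenius
eigenvalue `ρ` along a family of matrices whose entries obey a Hölder-type log-convexity in `θ`.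
Kingman's argument transfers this to `log ρ`: the weighted geometric mean of two Perron vectors is a
sub-invariant trial vector (`log_pfEigenvalue_le`). Equality forces the two matrices to agree up to
a scalar and a diagonal conjugation (`gauge_of_log_pfEigenvalue_eq`).

For the lower entropy the family is `W` times `exp (θ * increment)`. A single equality in the
convexity inequality therefore makes the increment a constant plus a coboundary on the support of
`W`, and then `log ρ` is linear in `θ`. So `log ρ` is either strictly convex or linear. Second-order
perturbation theory identifies `condVariance` with the asymptotic variance of the increment, which
vanishes exactly in the coboundary case (`condVariance_spec`). Monotonicity follows because the
entropy is minus the slope of the secant of `log ρ` from `0`; bounds near `-1` give the limit there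
and extend everything to the closed half-line.

For strongly non-hidden `W` everything lives on `Y`: the tilted matrix lumps to `nMatrix W θ 0` with
the same eigenvalue. Hölder is now used twice, in the sum over `x` and in the matrix product.
Equality in the first makes the increment a function of the `Y`-coordinates (`exists_hasPotential`);
equality in the second makes that function a coboundary. Hence the same dichotomy, with the same
variance, governs the upper and the two-parameter entropies.

The comparison of entropies and the maximization come from the entrywise identity `N_{θ,θ'} = K_θ ^
(1 + θ) * K_θ' ^ (-θ)` on the support of `marginal W`, solved for whichever matrix has positive
exponents on the other side, and log-convexity of `ρ`. First-order perturbation theory gives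
differentiability, and the derivative vanishes at the interior maximum. -/

set_option linter.unusedSectionVars false

/-! ### Perron-Frobenius theory for irreducible matrices -/

namespace MarkovRenyi

section PerronFrobenius

open Matrix

variable {n : Type*} [Fintype n] [DecidableEq n]

lemma exists_pow_pos {A : Matrix n n ℝ} (hA : A.IsIrreducible) (i j : n) :
    ∃ k > 0, 0 < (A ^ k) i j :=
  (Matrix.isIrreducible_iff_exists_pow_pos hA.nonneg).1 hA i j

lemma pow_nonneg_apply {A : Matrix n n ℝ} (hA : ∀ i j, 0 ≤ A i j) (k : ℕ) (i j : n) :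
    0 ≤ (A ^ k) i j := by
  induction k generalizing i j with
  | zero => simp only [pow_zero, Matrix.one_apply]; split_ifs <;> norm_num
  | succ k ih =>
    rw [pow_succ, Matrix.mul_apply]
    exact Finset.sum_nonneg fun l _ => mul_nonneg (ih _ _) (hA _ _)

/-- Positivity of entries of powers passes to an image state space. -/
lemma pow_pos_of_map {m : Type*} [Fintype m] [DecidableEq m] {A : Matrix n n ℝ}
    {B : Matrix m m ℝ} (π : n → m) (hA : ∀ i j, 0 ≤ A i j) (hB : ∀ i j, 0 ≤ B i j)
    (h : ∀ i j, 0 < A i j → 0 < B (π i) (π j)) (k : ℕ) (i j : n) (hk : 0 < (A ^ k) i j) :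
    0 < (B ^ k) (π i) (π j) := by
  induction k generalizing j with
  | zero =>
    have : i = j := by
      by_contra hij
      simp [hij] at hk
    simp [this]
  | succ k ih =>
    rw [pow_succ, Matrix.mul_apply] at hk
    obtain ⟨l, -, hl⟩ := Finset.exists_lt_of_sum_lt (s := Finset.univ) (f := fun _ => (0 : ℝ))
      (by simpa using hk)
    have h1 : 0 < (A ^ k) i l := lt_of_le_of_ne (pow_nonneg_apply hA _ _ _)
      (fun h0 => by simp [← h0] at hl)
    have h2 : 0 < A l j := lt_of_le_of_ne (hA _ _) (fun h0 => by simp [← h0] at hl)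
    rw [pow_succ, Matrix.mul_apply]
    refine lt_of_lt_of_le (mul_pos (ih l h1) (h l j h2))
      (Finset.single_le_sum (f := fun q => (B ^ k) (π i) q * B q (π j))
        (fun q _ => mul_nonneg (pow_nonneg_apply hB _ _ _) (hB _ _)) (Finset.mem_univ (π l)))

/-- Paths in the graph of `A` project to paths in the graph of `B`. With `π` the identity this moves
irreducibility between matrices of comparable support; with `π = Prod.snd` it passes to the
marginal. -/
lemma isIrreducible_of_map {m : Type*} [Fintype m] [DecidableEq m] {A : Matrix n n ℝ}
    {B : Matrix m m ℝ} (π : n → m) (hπ : Function.Surjective π) (hA : A.IsIrreducible)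
    (hB : ∀ i j, 0 ≤ B i j) (h : ∀ i j, 0 < A i j → 0 < B (π i) (π j)) : B.IsIrreducible := by
  rw [Matrix.isIrreducible_iff_exists_pow_pos hB]
  intro i j
  obtain ⟨i, rfl⟩ := hπ i
  obtain ⟨j, rfl⟩ := hπ j
  obtain ⟨k, hk, hk'⟩ := exists_pow_pos hA i j
  exact ⟨k, hk, pow_pos_of_map π hA.nonneg hB h k i j hk'⟩

lemma isIrreducible_of_pos {A B : Matrix n n ℝ} (hA : A.IsIrreducible)
    (hB : ∀ i j, 0 ≤ B i j) (h : ∀ i j, 0 < A i j → 0 < B i j) : B.IsIrreducible :=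
  isIrreducible_of_map id Function.surjective_id hA hB h

lemma pow_mulVec_eq {A : Matrix n n ℝ} {v : n → ℝ} {r : ℝ} (h : A *ᵥ v = r • v) (k : ℕ) :
    A ^ k *ᵥ v = r ^ k • v := by
  induction k with
  | zero => simp
  | succ k ih => rw [pow_succ, ← mulVec_mulVec, h, mulVec_smul, ih, smul_smul, pow_succ, mul_comm]

lemma mulVec_apply_pos {B : Matrix n n ℝ} (hB : ∀ i j, 0 ≤ B i j) {v : n → ℝ}
    (hv : ∀ i, 0 ≤ v i) {i j : n} (hij : 0 < B i j) (hj : 0 < v j) : 0 < (B *ᵥ v) i :=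
  lt_of_lt_of_le (mul_pos hij hj) (Finset.single_le_sum (f := fun q => B i q * v q)
    (fun _ _ => mul_nonneg (hB _ _) (hv _)) (Finset.mem_univ j))

/-- A nonnegative nonzero eigenvector of an irreducible matrix is positive. -/
lemma pos_of_mulVec_eq {A : Matrix n n ℝ} (hA : A.IsIrreducible) {v : n → ℝ} {r : ℝ}
    (hv : ∀ i, 0 ≤ v i) (hv0 : v ≠ 0) (h : A *ᵥ v = r • v) (i : n) : 0 < v i := by
  obtain ⟨j, hj⟩ : ∃ j, v j ≠ 0 := Function.ne_iff.1 hv0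
  obtain ⟨k, -, hk⟩ := exists_pow_pos hA i j
  have h1 := mulVec_apply_pos (pow_nonneg_apply hA.nonneg k) hv hk (lt_of_le_of_ne (hv j) hj.symm)
  rw [pow_mulVec_eq h] at h1
  refine lt_of_le_of_ne (hv i) fun h0 => ?_
  simp [← h0] at h1

/-- A sum of powers of `A`, one for each pair of states, is positive in every entry and still
commutes with `A`. It serves to spread a nonzero slack vector over all coordinates. -/
lemma exists_pos_commute {A : Matrix n n ℝ} (hA : A.IsIrreducible) :
    ∃ B : Matrix n n ℝ, (∀ i j, 0 < B i j) ∧ Commute A B := by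
  choose k hk hk' using exists_pow_pos hA
  refine ⟨∑ p : n × n, A ^ k p.1 p.2, fun i j => ?_, Commute.sum_right _ _ _ fun p _ =>
    Commute.pow_right rfl _⟩
  rw [Matrix.sum_apply]
  exact lt_of_lt_of_le (hk' i j) (Finset.single_le_sum (f := fun p : n × n => (A ^ k p.1 p.2) i j)
    (fun p _ => pow_nonneg_apply hA.nonneg _ _ _) (Finset.mem_univ (i, j)))

/-- Existence of a Perron vector: maximize `r` subject to `r x ≤ A x` over the simplex. -/
lemma exists_pos_mulVec_eq [Nonempty n] {A : Matrix n n ℝ} (hA : A.IsIrreducible) :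
    ∃ (r : ℝ) (v : n → ℝ), 0 < r ∧ (∀ i, 0 < v i) ∧ A *ᵥ v = r • v := by
  set C : ℝ := ∑ i, ∑ j, A i j with hC
  have hC0 : 0 ≤ C := Finset.sum_nonneg fun i _ => Finset.sum_nonneg fun j _ => hA.nonneg i j
  have hbound : ∀ (r : ℝ) (x : n → ℝ), x ∈ stdSimplex ℝ n → (∀ i, r * x i ≤ (A *ᵥ x) i) →
      r ≤ C := by
    intro r x hx hr
    have h1 : ∑ i, r * x i ≤ ∑ i, (A *ᵥ x) i := Finset.sum_le_sum fun i _ => hr i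
    rw [← Finset.mul_sum, hx.2, mul_one] at h1
    refine h1.trans (Finset.sum_le_sum fun i _ => Finset.sum_le_sum fun j _ => ?_)
    have : x j ≤ 1 := by
      rw [← hx.2]; exact Finset.single_le_sum (fun q _ => hx.1 q) (Finset.mem_univ j)
    exact mul_le_of_le_one_right (hA.nonneg i j) this
  -- The bound `C` on admissible `r` makes the set of pairs `(r, x)` compact, so the supremum is
  -- attained.
  set K : Set (ℝ × (n → ℝ)) :=
    (Icc 0 C ×ˢ stdSimplex ℝ n) ∩ {p | ∀ i, p.1 * p.2 i ≤ (A *ᵥ p.2) i} with hK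
  have hKc : IsCompact K := by
    refine (isCompact_Icc.prod (isCompact_stdSimplex ℝ n)).inter_right ?_
    simp only [Set.ofPred_forall]
    refine isClosed_iInter fun i => isClosed_le (by fun_prop) ?_
    simp only [mulVec, dotProduct]
    fun_prop
  have hKn : K.Nonempty := by
    obtain ⟨i⟩ := ‹Nonempty n›
    have hs := single_mem_stdSimplex ℝ i
    refine ⟨(0, Pi.single i 1), ⟨⟨le_rfl, hC0⟩, hs⟩, fun j => ?_⟩
    simp only [zero_mul]
    exact Finset.sum_nonneg fun q _ => mul_nonneg (hA.nonneg _ _) (hs.1 q)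
  obtain ⟨⟨r, v⟩, ⟨⟨⟨hr0, -⟩, hv⟩, hrv⟩, hmax⟩ := hKc.exists_isMaxOn hKn continuous_fst.continuousOn
  simp only [mem_ofPred_eq] at hrv hr0 hv
  have hv0 : v ≠ 0 := by
    rintro rfl
    simpa using hv.2
  have heq : A *ᵥ v = r • v := by
    by_contra hne
    obtain ⟨B, hB, hAB⟩ := exists_pos_commute hA
    set z : n → ℝ := A *ᵥ v - r • v with hz
    have hz0 : ∀ i, 0 ≤ z i := fun i => by simpa [hz] using hrv i
    obtain ⟨j, hj⟩ : ∃ j, z j ≠ 0 := Function.ne_iff.1 (sub_ne_zero.2 hne)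
    obtain ⟨l, hl⟩ : ∃ l, v l ≠ 0 := Function.ne_iff.1 hv0
    set w := B *ᵥ v with hw
    have hwpos : ∀ i, 0 < w i := fun i =>
      mulVec_apply_pos (fun i j => (hB i j).le) hv.1 (hB i l) (lt_of_le_of_ne (hv.1 l) hl.symm)
    have hzpos : ∀ i, 0 < (B *ᵥ z) i := fun i =>
      mulVec_apply_pos (fun i j => (hB i j).le) hz0 (hB i j) (lt_of_le_of_ne (hz0 j) hj.symm)
    have hBz : B *ᵥ z = A *ᵥ w - r • w := by
      rw [hz, mulVec_sub, mulVec_smul, mulVec_mulVec, hw, mulVec_mulVec, hAB.eq]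
    obtain ⟨i₀, hi₀⟩ := Finite.exists_min fun i => (B *ᵥ z) i / w i
    set ε := (B *ᵥ z) i₀ / w i₀ with hε
    have hεpos : 0 < ε := div_pos (hzpos _) (hwpos _)
    have hineq : ∀ i, (r + ε) * w i ≤ (A *ᵥ w) i := fun i => by
      have h1 := hi₀ i
      rw [le_div_iff₀ (hwpos i), hBz] at h1
      simp only [Pi.sub_apply, Pi.smul_apply, smul_eq_mul] at h1
      linarith
    set σ := ∑ i, w i with hσ
    have hσpos : 0 < σ := Finset.sum_pos (fun i _ => hwpos i) Finset.univ_nonempty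
    have hs : σ⁻¹ • w ∈ stdSimplex ℝ n :=
      ⟨fun i => mul_nonneg (inv_nonneg.2 hσpos.le) (hwpos i).le, by
        simp only [Pi.smul_apply, smul_eq_mul, ← Finset.mul_sum]
        exact inv_mul_cancel₀ hσpos.ne'⟩
    have hs' : ∀ i, (r + ε) * (σ⁻¹ • w) i ≤ (A *ᵥ (σ⁻¹ • w)) i := fun i => by
      rw [mulVec_smul]
      simp only [Pi.smul_apply, smul_eq_mul]
      have := mul_le_mul_of_nonneg_left (hineq i) (inv_nonneg.2 hσpos.le)
      linarith
    have hmem : ((r + ε, σ⁻¹ • w) : ℝ × (n → ℝ)) ∈ K :=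
      ⟨⟨⟨by positivity, hbound _ _ hs hs'⟩, hs⟩, hs'⟩
    have h3 : r + ε ≤ r := hmax hmem
    linarith
  have hvpos := pos_of_mulVec_eq hA hv.1 hv0 heq
  refine ⟨r, v, ?_, hvpos, heq⟩
  -- With `r = 0` every positive power of `A` would kill `v`, but some positive power has a positive
  -- diagonal entry.
  obtain ⟨i⟩ := ‹Nonempty n›
  obtain ⟨k, hk, hk'⟩ := exists_pow_pos hA i i
  have h1 := mulVec_apply_pos (pow_nonneg_apply hA.nonneg k) hv.1 hk' (hvpos i)
  rw [pow_mulVec_eq heq] at h1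
  refine lt_of_le_of_ne hr0 fun h0 => ?_
  simp [← h0, hk.ne'] at h1

lemma dotProduct_pos {u v : n → ℝ} [Nonempty n] (hu : ∀ i, 0 < u i) (hv : ∀ i, 0 < v i) :
    0 < u ⬝ᵥ v :=
  Finset.sum_pos (fun i _ => mul_pos (hu i) (hv i)) Finset.univ_nonempty

/-- The eigenvalue of a positive left eigenvector is the Perron-Frobenius eigenvalue. -/
lemma pfEigenvalue_eq_of_vecMul [Nonempty n] {A : Matrix n n ℝ} (hA : A.IsIrreducible)
    {u : n → ℝ} {r : ℝ} (hu : ∀ i, 0 < u i) (h : u ᵥ* A = r • u) : pfEigenvalue A = r := by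
  obtain ⟨r', v, hr', hv, hAv⟩ := exists_pos_mulVec_eq hA
  have hr : r' = r := by
    have h1 : u ⬝ᵥ (A *ᵥ v) = (u ᵥ* A) ⬝ᵥ v := dotProduct_mulVec _ _ _
    rw [h, hAv, dotProduct_smul, smul_dotProduct] at h1
    exact mul_right_cancel₀ (dotProduct_pos hu hv).ne' h1
  subst hr
  set Ac : Matrix n n ℂ := A.map (algebraMap ℝ ℂ) with hAc
  -- The moduli of a complex eigenvector satisfy `|μ| |z| ≤ A |z|`; pairing with the positive left
  -- eigenvector `u` removes `A`.
  have hle : ∀ μ ∈ spectrum ℂ Ac, ‖μ‖ ≤ r' := by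
    intro μ hμ
    rw [← Matrix.spectrum_toLin', ← Module.End.hasEigenvalue_iff_mem_spectrum] at hμ
    obtain ⟨z, hz⟩ := hμ.exists_hasEigenvector
    have hz1 : Ac *ᵥ z = μ • z := by simpa using hz.apply_eq_smul
    have hz2 : ∀ i, ‖μ‖ * ‖z i‖ ≤ (A *ᵥ fun j => ‖z j‖) i := by
      intro i
      have := congrFun hz1 i
      rw [← norm_mul, ← smul_eq_mul, ← Pi.smul_apply, ← this]
      refine (norm_sum_le _ _).trans (Finset.sum_le_sum fun j _ => ?_)
      rw [norm_mul]
      simp [hAc, abs_of_nonneg (hA.nonneg i j)]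
    have h1 : ‖μ‖ * (u ⬝ᵥ fun j => ‖z j‖) ≤ r' * (u ⬝ᵥ fun j => ‖z j‖) := by
      calc ‖μ‖ * (u ⬝ᵥ fun j => ‖z j‖) = ∑ i, u i * (‖μ‖ * ‖z i‖) := by
            simp only [dotProduct, Finset.mul_sum]
            exact Finset.sum_congr rfl fun i _ => by ring
        _ ≤ u ⬝ᵥ (A *ᵥ fun j => ‖z j‖) :=
            Finset.sum_le_sum fun i _ => mul_le_mul_of_nonneg_left (hz2 i) (hu i).le
        _ = r' * (u ⬝ᵥ fun j => ‖z j‖) := by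
            rw [dotProduct_mulVec, h, smul_dotProduct, smul_eq_mul]
    obtain ⟨j, hj⟩ : ∃ j, z j ≠ 0 := Function.ne_iff.1 hz.2
    refine le_of_mul_le_mul_right h1 ?_
    exact Finset.sum_pos' (fun i _ => mul_nonneg (hu i).le (norm_nonneg _))
      ⟨j, Finset.mem_univ j, mul_pos (hu j) (norm_pos_iff.2 hj)⟩
  have hmem : (r' : ℂ) ∈ spectrum ℂ Ac := by
    rw [← Matrix.spectrum_toLin', ← Module.End.hasEigenvalue_iff_mem_spectrum]
    refine Module.End.hasEigenvalue_of_hasEigenvector (x := fun i => (v i : ℂ)) ?_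
    refine Module.End.hasEigenvector_iff.2 ⟨Module.End.mem_eigenspace_iff.2 ?_, ?_⟩
    · ext i
      have := congrFun hAv i
      simp only [mulVec, dotProduct, Pi.smul_apply, smul_eq_mul] at this
      simp only [toLin'_apply, mulVec, dotProduct, hAc, map_apply, Pi.smul_apply, smul_eq_mul,
        Complex.coe_algebraMap]
      exact_mod_cast this
    · obtain ⟨i⟩ := ‹Nonempty n›
      intro h0
      have := congrFun h0 i
      simp only [Pi.zero_apply, Complex.ofReal_eq_zero] at this
      exact (hv i).ne' this
  have : spectralRadius ℂ Ac = ENNReal.ofReal r' := by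
    refine le_antisymm ?_ ?_
    · refine iSup₂_le fun μ hμ => ?_
      rw [ENNReal.ofReal, ENNReal.coe_le_coe, ← NNReal.coe_le_coe]
      simpa [hr'.le] using hle μ hμ
    · refine le_trans ?_ (le_iSup₂ (f := fun (k : ℂ) (_ : k ∈ spectrum ℂ Ac) => (‖k‖₊ : ENNReal))
        (r' : ℂ) hmem)
      rw [ENNReal.ofReal, ENNReal.coe_le_coe, ← NNReal.coe_le_coe]
      simp [abs_of_pos hr', hr'.le]
  have hnonneg : 0 ≤ r' := hr'.le
  rw [pfEigenvalue, ← hAc, this, ENNReal.toReal_ofReal hnonneg]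

/-- Positive left and right Perron vectors. -/
lemma exists_perron_vectors [Nonempty n] {A : Matrix n n ℝ} (hA : A.IsIrreducible) :
    ∃ u v : n → ℝ, (∀ i, 0 < u i) ∧ (∀ i, 0 < v i) ∧ u ᵥ* A = pfEigenvalue A • u ∧
      A *ᵥ v = pfEigenvalue A • v ∧ 0 < pfEigenvalue A := by
  obtain ⟨r, v, hr, hv, hAv⟩ := exists_pos_mulVec_eq hA
  obtain ⟨r', u, hr', hu, hAu⟩ := exists_pos_mulVec_eq hA.transpose
  rw [mulVec_transpose] at hAu
  have h1 : u ⬝ᵥ (A *ᵥ v) = (u ᵥ* A) ⬝ᵥ v := dotProduct_mulVec _ _ _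
  rw [hAu, hAv, dotProduct_smul, smul_dotProduct] at h1
  obtain rfl := mul_right_cancel₀ (dotProduct_pos hu hv).ne' h1
  rw [pfEigenvalue_eq_of_vecMul hA hu hAu]
  exact ⟨u, v, hu, hv, hAu, hAv, hr⟩

lemma pfEigenvalue_pos [Nonempty n] {A : Matrix n n ℝ} (hA : A.IsIrreducible) :
    0 < pfEigenvalue A := by
  obtain ⟨_, _, _, _, _, _, h⟩ := exists_perron_vectors hA
  exact h

lemma pfEigenvalue_transpose [Nonempty n] {A : Matrix n n ℝ} (hA : A.IsIrreducible) :
    pfEigenvalue Aᵀ = pfEigenvalue A := by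
  obtain ⟨u, v, hu, hv, hAu, hAv, h⟩ := exists_perron_vectors hA
  exact pfEigenvalue_eq_of_vecMul hA.transpose hv (by rw [vecMul_transpose, hAv])

/-- Collatz-Wielandt bound: pair the inequality with the positive left Perron vector. Together with
`le_pfEigenvalue` it reduces every estimate of the eigenvalue to a choice of trial vector. -/
lemma pfEigenvalue_le [Nonempty n] {A : Matrix n n ℝ} (hA : A.IsIrreducible) {w : n → ℝ}
    {μ : ℝ} (hw : ∀ i, 0 < w i) (h : ∀ i, (A *ᵥ w) i ≤ μ * w i) : pfEigenvalue A ≤ μ := by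
  obtain ⟨u, v, hu, hv, hAu, hAv, hr⟩ := exists_perron_vectors hA
  have h1 : u ⬝ᵥ (A *ᵥ w) ≤ μ * (u ⬝ᵥ w) := by
    simp only [dotProduct, Finset.mul_sum]
    exact Finset.sum_le_sum fun i _ => by nlinarith [h i, hu i]
  rw [dotProduct_mulVec, hAu, smul_dotProduct, smul_eq_mul] at h1
  exact le_of_mul_le_mul_right h1 (dotProduct_pos hu hw)

lemma le_pfEigenvalue [Nonempty n] {A : Matrix n n ℝ} (hA : A.IsIrreducible) {w : n → ℝ}
    {μ : ℝ} (hw : ∀ i, 0 < w i) (h : ∀ i, μ * w i ≤ (A *ᵥ w) i) : μ ≤ pfEigenvalue A := by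
  obtain ⟨u, v, hu, hv, hAu, hAv, hr⟩ := exists_perron_vectors hA
  have h1 : μ * (u ⬝ᵥ w) ≤ u ⬝ᵥ (A *ᵥ w) := by
    simp only [dotProduct, Finset.mul_sum]
    exact Finset.sum_le_sum fun i _ => by nlinarith [h i, hu i]
  rw [dotProduct_mulVec, hAu, smul_dotProduct, smul_eq_mul] at h1
  exact le_of_mul_le_mul_right h1 (dotProduct_pos hu hw)

/-- Paired with the left Perron vector, both sides have the same sum; all weights are positive, so
no coordinate can be strict. -/
lemma eq_of_pfEigenvalue_eq [Nonempty n] {A : Matrix n n ℝ} (hA : A.IsIrreducible) {w : n → ℝ}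
    (h : ∀ i, (A *ᵥ w) i ≤ pfEigenvalue A * w i) (i : n) :
    (A *ᵥ w) i = pfEigenvalue A * w i := by
  obtain ⟨u, v, hu, hv, hAu, hAv, hr⟩ := exists_perron_vectors hA
  have h1 : u ⬝ᵥ (A *ᵥ w) = pfEigenvalue A * (u ⬝ᵥ w) := by
    rw [dotProduct_mulVec, hAu, smul_dotProduct, smul_eq_mul]
  have h2 : ∑ i, u i * (A *ᵥ w) i = ∑ i, u i * (pfEigenvalue A * w i) := by
    refine h1.trans ?_
    simp only [dotProduct, Finset.mul_sum]
    exact Finset.sum_congr rfl fun i _ => by ring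
  have h3 := (Finset.sum_eq_sum_iff_of_le fun i _ =>
    mul_le_mul_of_nonneg_left (h i) (hu i).le).1 h2 i (Finset.mem_univ i)
  exact mul_left_cancel₀ (ne_of_gt (hu i)) h3

/-- Diagonal conjugation and scaling of an irreducible matrix. -/
lemma pfEigenvalue_gauge [Nonempty n] {A B : Matrix n n ℝ} (hA : A.IsIrreducible)
    (hB : B.IsIrreducible) (c : ℝ) (g : n → ℝ)
    (h : ∀ i j, A i j = Real.exp (c + g i - g j) * B i j) :
    pfEigenvalue A = Real.exp c * pfEigenvalue B := by
  obtain ⟨u, v, hu, hv, hBu, hBv, hr⟩ := exists_perron_vectors hB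
  refine pfEigenvalue_eq_of_vecMul hA (u := fun i => u i * Real.exp (-g i))
    (fun i => mul_pos (hu i) (Real.exp_pos _)) ?_
  ext j
  have h1 := congrFun hBu j
  simp only [vecMul, dotProduct, Pi.smul_apply, smul_eq_mul] at h1 ⊢
  calc ∑ i, u i * Real.exp (-g i) * A i j
      = ∑ i, Real.exp c * Real.exp (-g j) * (u i * B i j) := by
        refine Finset.sum_congr rfl fun i _ => ?_
        rw [h, show c + g i - g j = c + (g i) + (-g j) by ring, Real.exp_add, Real.exp_add]
        have : Real.exp (-g i) * Real.exp (g i) = 1 := by rw [← Real.exp_add]; simp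
        linear_combination (u i * Real.exp c * Real.exp (-g j) * B i j) * this
    _ = _ := by rw [← Finset.mul_sum, h1]; ring

end PerronFrobenius

end MarkovRenyi

/-! ### Hölder's inequality and log-convexity of the Perron-Frobenius eigenvalue -/

namespace MarkovRenyi

section Kingman

open Matrix

lemma rpow_mul_rpow_div {x y P Q a b : ℝ} (hx : 0 ≤ x) (hy : 0 ≤ y) (hP : 0 < P)
    (hQ : 0 < Q) : (x / P) ^ a * (y / Q) ^ b = x ^ a * y ^ b / (P ^ a * Q ^ b) := by
  rw [Real.div_rpow hx hP.le, Real.div_rpow hy hQ.le]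
  field_simp

/-- Hölder's inequality for two sequences of total mass `∑ p`, `∑ q`. -/
lemma sum_rpow_mul_rpow_le {ι : Type*} [Fintype ι] {p q : ι → ℝ} {a b : ℝ} (ha : 0 < a)
    (hb : 0 < b) (hab : a + b = 1) (hp : ∀ i, 0 ≤ p i) (hq : ∀ i, 0 ≤ q i) (hP : 0 < ∑ i, p i)
    (hQ : 0 < ∑ i, q i) : ∑ i, p i ^ a * q i ^ b ≤ (∑ i, p i) ^ a * (∑ i, q i) ^ b := by
  set P := ∑ i, p i with hPdef
  set Q := ∑ i, q i with hQdef
  have h1 : ∑ i, (p i / P) ^ a * (q i / Q) ^ b ≤ ∑ i, (a * (p i / P) + b * (q i / Q)) :=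
    Finset.sum_le_sum fun i _ => Real.geom_mean_le_arith_mean2_weighted ha.le hb.le
      (div_nonneg (hp i) hP.le) (div_nonneg (hq i) hQ.le) hab
  have h2 : ∑ i, (a * (p i / P) + b * (q i / Q)) = 1 := by
    rw [Finset.sum_add_distrib, ← Finset.mul_sum, ← Finset.mul_sum, ← Finset.sum_div,
      ← Finset.sum_div, ← hPdef, ← hQdef, div_self hP.ne', div_self hQ.ne', mul_one, mul_one, hab]
  simp only [rpow_mul_rpow_div (hp _) (hq _) hP hQ, ← Finset.sum_div] at h1
  rw [h2, div_le_one (by positivity)] at h1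
  exact h1

/-- The equality case of Hölder's inequality. -/
lemma mul_sum_eq_of_sum_rpow_mul_rpow_eq {ι : Type*} [Fintype ι] {p q : ι → ℝ} {a b : ℝ}
    (ha : 0 < a) (hb : 0 < b) (hab : a + b = 1) (hp : ∀ i, 0 ≤ p i) (hq : ∀ i, 0 ≤ q i)
    (hP : 0 < ∑ i, p i) (hQ : 0 < ∑ i, q i)
    (h : ∑ i, p i ^ a * q i ^ b = (∑ i, p i) ^ a * (∑ i, q i) ^ b) (i : ι) :
    p i * ∑ i, q i = q i * ∑ i, p i := by
  set P := ∑ i, p i with hPdef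
  set Q := ∑ i, q i with hQdef
  have h2 : ∑ i, (a * (p i / P) + b * (q i / Q)) = 1 := by
    rw [Finset.sum_add_distrib, ← Finset.mul_sum, ← Finset.mul_sum, ← Finset.sum_div,
      ← Finset.sum_div, ← hPdef, ← hQdef, div_self hP.ne', div_self hQ.ne', mul_one, mul_one, hab]
  have h1 : ∑ i, (p i / P) ^ a * (q i / Q) ^ b = ∑ i, (a * (p i / P) + b * (q i / Q)) := by
    simp only [rpow_mul_rpow_div (hp _) (hq _) hP hQ, ← Finset.sum_div]
    rw [h2, h, div_self (by positivity)]
  have h3 := (Finset.sum_eq_sum_iff_of_le fun i _ =>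
    Real.geom_mean_le_arith_mean2_weighted ha.le hb.le
      (div_nonneg (hp i) hP.le) (div_nonneg (hq i) hQ.le) hab).1 h1 i (Finset.mem_univ i)
  rw [Real.geom_mean_eq_arith_mean2_weighted_iff_of_pos ha hb (div_nonneg (hp i) hP.le)
      (div_nonneg (hq i) hQ.le) hab] at h3
  rwa [div_eq_div_iff hP.ne' hQ.ne'] at h3

variable {n : Type*} [Fintype n] [DecidableEq n] [Nonempty n]

/-- Kingman's argument: the trial vector is the weighted geometric mean of the right Perron vectors,
and Hölder in each row bounds the result. The two inequalities are kept apart because the equality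
case needs both: the first gives entrywise equality, the second proportional rows. -/
lemma exists_subinvariant_vector {A B C : Matrix n n ℝ} (hA : A.IsIrreducible)
    (hB : B.IsIrreducible) {a b : ℝ} (ha : 0 < a) (hb : 0 < b) (hab : a + b = 1)
    (h : ∀ i j, C i j ≤ A i j ^ a * B i j ^ b) :
    ∃ vA vB : n → ℝ, (∀ i, 0 < vA i) ∧ (∀ i, 0 < vB i) ∧ A *ᵥ vA = pfEigenvalue A • vA ∧
      B *ᵥ vB = pfEigenvalue B • vB ∧
      (∀ i, (C *ᵥ fun j => vA j ^ a * vB j ^ b) i ≤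
        ∑ j, (A i j * vA j) ^ a * (B i j * vB j) ^ b) ∧
      ∀ i, ∑ j, (A i j * vA j) ^ a * (B i j * vB j) ^ b ≤
        pfEigenvalue A ^ a * pfEigenvalue B ^ b * (vA i ^ a * vB i ^ b) := by
  obtain ⟨-, vA, -, hvA, -, hA', hrA⟩ := exists_perron_vectors hA
  obtain ⟨-, vB, -, hvB, -, hB', hrB⟩ := exists_perron_vectors hB
  refine ⟨vA, vB, hvA, hvB, hA', hB', fun i => Finset.sum_le_sum fun j _ => ?_, fun i => ?_⟩
  · rw [Real.mul_rpow (hA.nonneg i j) (hvA j).le, Real.mul_rpow (hB.nonneg i j) (hvB j).le]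
    have h0 : 0 ≤ vA j ^ a * vB j ^ b :=
      mul_nonneg (Real.rpow_nonneg (hvA j).le _) (Real.rpow_nonneg (hvB j).le _)
    calc C i j * (vA j ^ a * vB j ^ b) ≤ A i j ^ a * B i j ^ b * (vA j ^ a * vB j ^ b) :=
          mul_le_mul_of_nonneg_right (h i j) h0
      _ = _ := by ring
  · have eA : ∑ j, A i j * vA j = pfEigenvalue A * vA i := congrFun hA' i
    have eB : ∑ j, B i j * vB j = pfEigenvalue B * vB i := congrFun hB' i
    refine (sum_rpow_mul_rpow_le ha hb hab (fun j => mul_nonneg (hA.nonneg i j) (hvA j).le)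
      (fun j => mul_nonneg (hB.nonneg i j) (hvB j).le) ?_ ?_).trans_eq ?_
    · rw [eA]; exact mul_pos hrA (hvA i)
    · rw [eB]; exact mul_pos hrB (hvB i)
    · rw [eA, eB, Real.mul_rpow hrA.le (hvA i).le, Real.mul_rpow hrB.le (hvB i).le]
      ring

/-- Log-convexity of the Perron-Frobenius eigenvalue. -/
lemma log_pfEigenvalue_le {A B C : Matrix n n ℝ} (hA : A.IsIrreducible)
    (hB : B.IsIrreducible) (hC : C.IsIrreducible) {a b : ℝ} (ha : 0 < a) (hb : 0 < b)
    (hab : a + b = 1) (h : ∀ i j, C i j ≤ A i j ^ a * B i j ^ b) :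
    Real.log (pfEigenvalue C) ≤
      a * Real.log (pfEigenvalue A) + b * Real.log (pfEigenvalue B) := by
  obtain ⟨vA, vB, hvA, hvB, -, -, h1, h2⟩ := exists_subinvariant_vector hA hB ha hb hab h
  have hrA := pfEigenvalue_pos hA
  have hrB := pfEigenvalue_pos hB
  have := pfEigenvalue_le hC (fun i => mul_pos (Real.rpow_pos_of_pos (hvA i) a)
    (Real.rpow_pos_of_pos (hvB i) b)) fun i => (h1 i).trans (h2 i)
  refine (Real.log_le_log (pfEigenvalue_pos hC) this).trans_eq ?_
  rw [Real.log_mul (by positivity) (by positivity), Real.log_rpow hrA, Real.log_rpow hrB]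

/-- The equality case of log-convexity of the Perron-Frobenius eigenvalue. -/
lemma gauge_of_log_pfEigenvalue_eq {A B C : Matrix n n ℝ} (hA : A.IsIrreducible)
    (hB : B.IsIrreducible) (hC : C.IsIrreducible) {a b : ℝ} (ha : 0 < a) (hb : 0 < b)
    (hab : a + b = 1) (h : ∀ i j, C i j ≤ A i j ^ a * B i j ^ b)
    (heq : Real.log (pfEigenvalue C) =
      a * Real.log (pfEigenvalue A) + b * Real.log (pfEigenvalue B)) :
    (∀ i j, C i j = A i j ^ a * B i j ^ b) ∧
      ∃ (c : ℝ) (g : n → ℝ), ∀ i j, A i j = Real.exp (c + g i - g j) * B i j := by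
  obtain ⟨vA, vB, hvA, hvB, hA', hB', h1, h2⟩ := exists_subinvariant_vector hA hB ha hb hab h
  have hrA := pfEigenvalue_pos hA
  have hrB := pfEigenvalue_pos hB
  have hr : pfEigenvalue C = pfEigenvalue A ^ a * pfEigenvalue B ^ b := by
    refine Real.log_injOn_pos (pfEigenvalue_pos hC) (mem_Ioi.2 (by positivity)) ?_
    rw [heq, Real.log_mul (by positivity) (by positivity), Real.log_rpow hrA, Real.log_rpow hrB]
  rw [← hr] at h2
  have h3 := eq_of_pfEigenvalue_eq hC fun i => (h1 i).trans (h2 i)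
  -- The outer terms of the chain coincide, so both of its inequalities are equalities.
  have h4 : ∀ i, (C *ᵥ fun j => vA j ^ a * vB j ^ b) i =
      ∑ j, (A i j * vA j) ^ a * (B i j * vB j) ^ b := fun i =>
    le_antisymm (h1 i) ((h2 i).trans_eq (h3 i).symm)
  have h5 : ∀ i, ∑ j, (A i j * vA j) ^ a * (B i j * vB j) ^ b =
      pfEigenvalue A ^ a * pfEigenvalue B ^ b * (vA i ^ a * vB i ^ b) := fun i => by
    rw [← h4, h3, hr]
  refine ⟨fun i j => ?_, Real.log (pfEigenvalue A / pfEigenvalue B),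
    fun i => Real.log (vA i / vB i), fun i j => ?_⟩
  · have hpos : ∀ j, 0 < vA j ^ a * vB j ^ b := fun j =>
      mul_pos (Real.rpow_pos_of_pos (hvA j) a) (Real.rpow_pos_of_pos (hvB j) b)
    have h6 : ∑ j, C i j * (vA j ^ a * vB j ^ b) =
        ∑ j, A i j ^ a * B i j ^ b * (vA j ^ a * vB j ^ b) := by
      refine (h4 i).trans (Finset.sum_congr rfl fun j _ => ?_)
      rw [Real.mul_rpow (hA.nonneg i j) (hvA j).le, Real.mul_rpow (hB.nonneg i j) (hvB j).le]
      ring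
    have h7 := (Finset.sum_eq_sum_iff_of_le fun j _ =>
      mul_le_mul_of_nonneg_right (h i j) (hpos j).le).1 h6 j (Finset.mem_univ j)
    exact mul_right_cancel₀ (hpos j).ne' h7
  · have eA : ∑ j, A i j * vA j = pfEigenvalue A * vA i := congrFun hA' i
    have eB : ∑ j, B i j * vB j = pfEigenvalue B * vB i := congrFun hB' i
    -- Equality in Hölder makes row `i` of `A` weighted by `vA` proportional to row `i` of `B`
    -- weighted by `vB`; the row sums are known from the eigenvector equations, which gives the
    -- gauge explicitly.
    have h6 := mul_sum_eq_of_sum_rpow_mul_rpow_eq ha hb hab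
      (fun j => mul_nonneg (hA.nonneg i j) (hvA j).le)
      (fun j => mul_nonneg (hB.nonneg i j) (hvB j).le)
      (by rw [eA]; exact mul_pos hrA (hvA i)) (by rw [eB]; exact mul_pos hrB (hvB i))
      (by rw [h5, eA, eB, Real.mul_rpow hrA.le (hvA i).le, Real.mul_rpow hrB.le (hvB i).le]; ring) j
    rw [eA, eB] at h6
    have i1 := hvA i
    have i2 := hvB i
    have i3 := hvA j
    have i4 := hvB j
    rw [Real.exp_sub, Real.exp_add, Real.exp_log (by positivity), Real.exp_log (by positivity),
      Real.exp_log (by positivity)]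
    field_simp
    linear_combination h6

end Kingman

end MarkovRenyi

/-! ### Perturbation theory of the Perron-Frobenius eigenvalue -/

namespace MarkovRenyi

section Perturbation

open Matrix Asymptotics

variable {n : Type*} [Fintype n] [DecidableEq n] [Nonempty n]

/-- The Perron-Frobenius eigenvalue is geometrically simple. -/
lemma exists_smul_of_mulVec_eq {A : Matrix n n ℝ} (hA : A.IsIrreducible) {v x : n → ℝ} {r : ℝ}
    (hv : ∀ i, 0 < v i) (hAv : A *ᵥ v = r • v) (hAx : A *ᵥ x = r • x) : ∃ c : ℝ, c • v = x := by
  -- Subtract the largest multiple of `v` that leaves `x` nonnegative. The difference vanishes at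
  -- `i₀`, whereas a nonzero nonnegative eigenvector is positive.
  obtain ⟨i₀, hi₀⟩ := Finite.exists_min fun i => x i / v i
  refine ⟨x i₀ / v i₀, ?_⟩
  by_contra hne
  have h1 : A *ᵥ (x - (x i₀ / v i₀) • v) = r • (x - (x i₀ / v i₀) • v) := by
    rw [mulVec_sub, mulVec_smul, hAv, hAx, smul_sub, smul_comm]
  have h2 : ∀ i, 0 ≤ (x - (x i₀ / v i₀) • v) i := fun i => by
    have := hi₀ i
    rw [le_div_iff₀ (hv i)] at this
    simpa using this
  have h3 := pos_of_mulVec_eq hA h2 (sub_ne_zero.2 (Ne.symm hne)) h1 i₀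
  have := (hv i₀).ne'
  simp [this] at h3

/-- Solvability of the Poisson equation. -/
lemma exists_mulVec_sub_smul_eq {A : Matrix n n ℝ} (hA : A.IsIrreducible) {u v z : n → ℝ} {r : ℝ}
    (hu : ∀ i, 0 < u i) (hv : ∀ i, 0 < v i) (hAu : u ᵥ* A = r • u) (hAv : A *ᵥ v = r • v)
    (hz : u ⬝ᵥ z = 0) : ∃ h : n → ℝ, A *ᵥ h - r • h = z := by
  set T : (n → ℝ) →ₗ[ℝ] (n → ℝ) := A.mulVecLin - r • LinearMap.id with hT
  have hTx : ∀ x, T x = A *ᵥ x - r • x := fun x => by simp [hT]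
  set ℓ : (n → ℝ) →ₗ[ℝ] ℝ := dotProductBilin ℝ ℝ u with hℓ
  have hℓx : ∀ x, ℓ x = u ⬝ᵥ x := fun x => by simp [hℓ]
  have hv0 : v ≠ 0 := by
    obtain ⟨i⟩ := ‹Nonempty n›
    exact fun h => (hv i).ne' (congrFun h i)
  have hℓ0 : ℓ ≠ 0 := fun h => (dotProduct_pos hu hv).ne' (by rw [← hℓx, h]; rfl)
  have hker : LinearMap.ker T = Submodule.span ℝ {v} := by
    ext x
    rw [LinearMap.mem_ker, hTx, sub_eq_zero, Submodule.mem_span_singleton]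
    refine ⟨exists_smul_of_mulVec_eq hA hv hAv, ?_⟩
    rintro ⟨c, rfl⟩
    rw [mulVec_smul, hAv, smul_comm]
  have h1 : Module.finrank ℝ (LinearMap.ker T) = 1 := by
    rw [hker, finrank_span_singleton hv0]
  have h2 := LinearMap.finrank_range_add_finrank_ker T
  have h3 := Module.Dual.finrank_ker_add_one_of_ne_zero (f := ℓ) hℓ0
  have hle : LinearMap.range T ≤ LinearMap.ker ℓ := by
    rintro _ ⟨x, rfl⟩
    rw [LinearMap.mem_ker, hℓx, hTx, dotProduct_sub, dotProduct_mulVec, hAu, smul_dotProduct,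
      dotProduct_smul, sub_self]
  -- The range lies in the hyperplane orthogonal to `u`, and the one-dimensional kernel of `T` makes
  -- the dimensions equal.
  have heq : LinearMap.range T = LinearMap.ker ℓ :=
    Submodule.eq_of_le_of_finrank_eq hle (by omega)
  have hzmem : z ∈ LinearMap.range T := by rw [heq, LinearMap.mem_ker, hℓx, hz]
  obtain ⟨h, hh⟩ := hzmem
  exact ⟨h, by rw [← hTx, hh]⟩

/-- Approximate positive eigenvectors determine the Perron-Frobenius eigenvalue asymptotically. -/
lemma pfEigenvalue_sub_isLittleO {l : Filter ℝ} {A : ℝ → Matrix n n ℝ} {w : ℝ → n → ℝ}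
    {μ b : ℝ → ℝ} {δ : ℝ} (hδ : 0 < δ) (hA : ∀ᶠ t in l, (A t).IsIrreducible)
    (hw : ∀ i, ∀ᶠ t in l, δ ≤ w t i)
    (h : ∀ i, (fun t => (A t *ᵥ w t) i - μ t * w t i) =o[l] b) :
    (fun t => pfEigenvalue (A t) - μ t) =o[l] b := by
  rw [isLittleO_iff]
  intro c hc
  have h1 : ∀ i, ∀ᶠ t in l, ‖(A t *ᵥ w t) i - μ t * w t i‖ ≤ c * δ * ‖b t‖ := fun i =>
    isLittleO_iff.1 (h i) (mul_pos hc hδ)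
  filter_upwards [hA, eventually_all.2 hw, eventually_all.2 h1] with t hAt hwt ht
  have hpos : ∀ i, 0 < w t i := fun i => hδ.trans_le (hwt i)
  -- The uniform lower bound `δ` on the trial vector turns an absolute error into one relative to `w
  -- t i`, as the Collatz-Wielandt bounds require.
  have h2 : ∀ i, |(A t *ᵥ w t) i - μ t * w t i| ≤ c * ‖b t‖ * w t i := fun i =>
    (ht i).trans (by nlinarith [hwt i, mul_nonneg hc.le (norm_nonneg (b t))])
  rw [Real.norm_eq_abs, abs_le]
  constructor
  · have := le_pfEigenvalue hAt (μ := μ t - c * ‖b t‖) hpos fun i => by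
      have := (abs_le.1 (h2 i)).1
      linarith
    linarith
  · have := pfEigenvalue_le hAt (μ := μ t + c * ‖b t‖) hpos fun i => by
      have := (abs_le.1 (h2 i)).2
      linarith
    linarith

/-- The Perron-Frobenius eigenvalue is differentiable along differentiable families of irreducible
matrices, with a derivative that depends only on the matrix and the derivatives of its entries. -/
lemma exists_hasDerivAt_pfEigenvalue {A₀ : Matrix n n ℝ} (hA₀ : A₀.IsIrreducible) :
    ∃ L : Matrix n n ℝ → ℝ, ∀ (A : ℝ → Matrix n n ℝ) (A' : Matrix n n ℝ) (t₀ : ℝ), A t₀ = A₀ →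
      (∀ᶠ t in 𝓝 t₀, (A t).IsIrreducible) →
      (∀ i j, HasDerivAt (fun t => A t i j) (A' i j) t₀) →
      HasDerivAt (fun t => pfEigenvalue (A t)) (L A') t₀ := by
  obtain ⟨u, v, hu, hv, hAu, hAv, hr⟩ := exists_perron_vectors hA₀
  have huv := dotProduct_pos hu hv
  refine ⟨fun A' => u ⬝ᵥ (A' *ᵥ v) / (u ⬝ᵥ v), ?_⟩
  rintro A A' t₀ rfl hA hA'
  set r := pfEigenvalue (A t₀) with hrdef
  set m := u ⬝ᵥ (A' *ᵥ v) / (u ⬝ᵥ v) with hm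
  -- The corrector `h` solves `A h + A' v = r h + m v`, so that `v + (t - t₀) h` is an eigenvector
  -- for `r + (t - t₀) m` up to `o(t - t₀)`. Solvability against `u` dictates the value of `m`.
  obtain ⟨h, hh⟩ := exists_mulVec_sub_smul_eq hA₀ (z := m • v - A' *ᵥ v) hu hv hAu hAv (by
    rw [dotProduct_sub, dotProduct_smul, smul_eq_mul, hm, div_mul_cancel₀ _ huv.ne', sub_self])
  obtain ⟨i₀, hi₀⟩ := Finite.exists_min v
  rw [hasDerivAt_iff_isLittleO]
  have key := pfEigenvalue_sub_isLittleO (A := A) (l := 𝓝 t₀) (w := fun t i => v i + (t - t₀) * h i)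
    (μ := fun t => r + (t - t₀) * m) (b := fun t => t - t₀) (δ := v i₀ / 2)
    (half_pos (hv i₀)) hA ?_ ?_
  · refine key.congr_left fun t => ?_
    simp only [smul_eq_mul]
    ring
  · intro i
    have hc : Tendsto (fun t => v i + (t - t₀) * h i) (𝓝 t₀) (𝓝 (v i + (t₀ - t₀) * h i)) :=
      Continuous.tendsto (by fun_prop) t₀
    rw [sub_self, zero_mul, add_zero] at hc
    exact (hc.eventually_const_lt (u := v i₀ / 2)
      (by linarith [hi₀ i, hv i₀])).mono fun t ht => ht.le
  · intro i
    have hw : ∀ j, HasDerivAt (fun t => v j + (t - t₀) * h j) (h j) t₀ := fun j => by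
      simpa using (((hasDerivAt_id t₀).sub_const t₀).mul_const (h j)).const_add (v j)
    have hμ : HasDerivAt (fun t => r + (t - t₀) * m) m t₀ := by
      simpa using (((hasDerivAt_id t₀).sub_const t₀).mul_const m).const_add r
    have h1 : HasDerivAt (fun t => (A t *ᵥ fun j => v j + (t - t₀) * h j) i -
        (r + (t - t₀) * m) * (v i + (t - t₀) * h i))
        (∑ j, (A' i j * v j + A t₀ i j * h j) - (m * v i + r * h i)) t₀ := by
      simp only [mulVec, dotProduct]
      refine HasDerivAt.sub (HasDerivAt.fun_sum fun j _ => ?_) ?_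
      · simpa using (hA' i j).fun_mul (hw j)
      · simpa using hμ.fun_mul (hw i)
    have h2 : ∑ j, (A' i j * v j + A t₀ i j * h j) - (m * v i + r * h i) = 0 := by
      have := congrFun hh i
      simp only [mulVec, dotProduct, Pi.sub_apply, Pi.smul_apply, smul_eq_mul] at this
      rw [Finset.sum_add_distrib]
      linarith
    rw [h2, hasDerivAt_iff_isLittleO] at h1
    refine h1.congr_left fun t => ?_
    have h3 : (A t₀ *ᵥ fun j => v j + (t₀ - t₀) * h j) i = r * v i := by
      simpa using congrFun hAv i
    simp only [h3]
    simp

/-- Second-order expansion of the Perron-Frobenius eigenvalue of `P e^{t f}` for a stochastic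
matrix `P`; the second-order coefficient is an asymptotic variance. -/
lemma exists_tendsto_log_pfEigenvalue_exp {P : Matrix n n ℝ} (hP : P.IsIrreducible)
    (hP1 : ∀ i, ∑ j, P i j = 1) (f : n → n → ℝ) :
    ∃ m V : ℝ, 0 ≤ V ∧
      Tendsto (fun t => (Real.log (pfEigenvalue (Matrix.of fun i j => P i j * Real.exp (t * f i j)))
        - t * m) / t ^ 2) (𝓝[≠] 0) (𝓝 (V / 2)) ∧
      (V = 0 → ∃ g : n → ℝ, ∀ i j, 0 < P i j → f i j = m + g i - g j) := by
  obtain ⟨u, -, hu, -, hPu, -, -⟩ := exists_perron_vectors hP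
  have hP1' : P *ᵥ (1 : n → ℝ) = (1 : ℝ) • (1 : n → ℝ) := by
    ext i; simpa [mulVec, dotProduct] using hP1 i
  have hone : ∀ i : n, 0 < (1 : n → ℝ) i := fun i => by simp
  have huv := dotProduct_pos hu hone
  have hr : pfEigenvalue P = 1 := by
    have h1 : u ⬝ᵥ (P *ᵥ 1) = (u ᵥ* P) ⬝ᵥ 1 := dotProduct_mulVec _ _ _
    rw [hPu, hP1', one_smul, smul_dotProduct, smul_eq_mul] at h1
    exact mul_right_cancel₀ huv.ne' (by rw [one_mul]; exact h1.symm)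
  rw [hr] at hPu
  have poisson : ∀ z : n → ℝ, ∃ k : n → ℝ, ∀ i,
      z i + ∑ j, P i j * k j - k i = u ⬝ᵥ z / (u ⬝ᵥ 1) := fun z => by
    obtain ⟨k, hk⟩ := exists_mulVec_sub_smul_eq hP (z := (u ⬝ᵥ z / (u ⬝ᵥ 1)) • (1 : n → ℝ) - z)
      hu hone hPu hP1' (by
        rw [dotProduct_sub, dotProduct_smul, smul_eq_mul, div_mul_cancel₀ _ huv.ne', sub_self])
    refine ⟨k, fun i => ?_⟩
    have := congrFun hk i
    simp only [mulVec, dotProduct, Pi.sub_apply, Pi.smul_apply, smul_eq_mul, Pi.one_apply] at this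
    simp only [dotProduct, Pi.one_apply]
    linarith
  obtain ⟨h, hh⟩ := poisson fun i => ∑ j, P i j * f i j
  set m := (u ⬝ᵥ fun i => ∑ j, P i j * f i j) / (u ⬝ᵥ 1) with hm
  -- Subtracting the mean and a coboundary makes every conditional mean of `F` zero; in terms of `f`
  -- this is a gauge change, which multiplies the eigenvalue by `exp (t * m)`.
  set F : n → n → ℝ := fun i j => f i j + h j - h i - m with hF
  have hPF : ∀ i, ∑ j, P i j * F i j = 0 := fun i => by
    have : ∑ j, P i j * F i j = ∑ j, P i j * f i j + ∑ j, P i j * h j - (∑ j, P i j) * (h i + m) := by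
      rw [Finset.sum_mul, ← Finset.sum_add_distrib, ← Finset.sum_sub_distrib]
      exact Finset.sum_congr rfl fun j _ => by simp only [hF]; ring
    rw [this, hP1]
    linarith [hh i]
  set Q : n → ℝ := fun i => ∑ j, P i j * F i j ^ 2 with hQ
  have hQ0 : ∀ i, 0 ≤ Q i := fun i =>
    Finset.sum_nonneg fun j _ => mul_nonneg (hP.nonneg i j) (sq_nonneg _)
  -- A second corrector replaces the conditional variances by their stationary mean: `1 + t ^ 2 * k`
  -- is then an eigenvector up to `o(t ^ 2)`, with eigenvalue `1 + t ^ 2 * σ`.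
  obtain ⟨k, hk⟩ := poisson fun i => Q i / 2
  set σ := (u ⬝ᵥ fun i => Q i / 2) / (u ⬝ᵥ 1) with hσ
  have hσ0 : 0 ≤ σ := div_nonneg (Finset.sum_nonneg fun i _ =>
    mul_nonneg (hu i).le (div_nonneg (hQ0 i) two_pos.le)) huv.le
  refine ⟨m, 2 * σ, by positivity, ?_, fun hV => ⟨h, fun i j hij => ?_⟩⟩
  · set A : ℝ → Matrix n n ℝ := fun t => Matrix.of fun i j => P i j * Real.exp (t * F i j) with hA
    have irr : ∀ (t : ℝ) (G : n → n → ℝ),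
        (Matrix.of fun i j => P i j * Real.exp (t * G i j)).IsIrreducible := fun t G =>
      isIrreducible_of_pos hP (fun i j => mul_nonneg (hP.nonneg i j) (Real.exp_pos _).le)
        fun i j hij => mul_pos hij (Real.exp_pos _)
    have hgauge : ∀ t, Real.log (pfEigenvalue (Matrix.of fun i j => P i j * Real.exp (t * f i j)))
        = t * m + Real.log (pfEigenvalue (A t)) := fun t => by
      rw [pfEigenvalue_gauge (irr t f) (irr t F) (t * m) (fun i => t * h i) fun i j => ?_,
        Real.log_mul (Real.exp_pos _).ne' (pfEigenvalue_pos (irr t F)).ne', Real.log_exp]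
      simp only [of_apply, hF]
      rw [mul_left_comm, ← Real.exp_add]
      congr 2
      ring
    have hexp : ∀ i j, (fun t : ℝ => Real.exp (t * F i j) - 1 - t * F i j - t ^ 2 * F i j ^ 2 / 2)
        =o[𝓝 0] fun t => t ^ 2 := fun i j => by
      have h0 : Tendsto (fun t : ℝ => t * F i j) (𝓝 0) (𝓝 0) := by
        simpa using (continuous_id.mul_const (F i j)).tendsto 0
      have h1 := (Real.exp_sub_sum_range_succ_isLittleO_pow 2).comp_tendsto h0
      have h2 : ((fun x : ℝ => x ^ 2) ∘ fun t : ℝ => t * F i j) =O[𝓝 0] fun t => t ^ 2 := by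
        refine IsBigO.of_bound (F i j ^ 2) (Eventually.of_forall fun t => ?_)
        simp only [Function.comp_apply, norm_pow, norm_mul]
        rw [mul_pow, mul_comm]
        simp
      refine (h1.trans_isBigO h2).congr_left fun t => ?_
      simp [Finset.sum_range_succ, Nat.factorial]
      ring
    have hone_sub : (fun t : ℝ => Real.exp t - 1) =o[𝓝 0] fun _ => (1 : ℝ) := by
      rw [isLittleO_one_iff]
      have : Tendsto (fun t : ℝ => Real.exp t - 1) (𝓝 0) (𝓝 (Real.exp 0 - 1)) :=
        Continuous.tendsto (by fun_prop) 0
      simpa using this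
    have key := pfEigenvalue_sub_isLittleO (A := A) (l := 𝓝 0) (w := fun t i => 1 + t ^ 2 * k i)
      (μ := fun t => 1 + t ^ 2 * σ) (b := fun t => t ^ 2) (δ := 1 / 2) (by norm_num)
      (Eventually.of_forall fun t => irr t F) ?_ ?_
    · have hρ1 : (fun t => pfEigenvalue (A t) - 1) =O[𝓝 0] fun t => t ^ 2 := by
        have h1 : (fun t : ℝ => t ^ 2 * σ) =O[𝓝 0] fun t => t ^ 2 :=
          IsBigO.of_bound |σ| (Eventually.of_forall fun t => by
            rw [norm_mul, mul_comm, Real.norm_eq_abs σ])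
        refine (key.isBigO.add h1).congr_left fun t => by ring
      have hρ : Tendsto (fun t => pfEigenvalue (A t)) (𝓝 0) (𝓝 1) := by
        have h1 : Tendsto (fun t : ℝ => t ^ 2) (𝓝 0) (𝓝 0) := by
          simpa using (continuous_pow 2).tendsto (0 : ℝ)
        simpa using (hρ1.trans_tendsto h1).add_const 1
      have hlog : (fun t => Real.log (pfEigenvalue (A t)) - (pfEigenvalue (A t) - 1)) =o[𝓝 0]
          fun t => t ^ 2 := by
        have h1 := hasDerivAt_iff_isLittleO.1 (Real.hasDerivAt_log one_ne_zero)
        refine ((h1.comp_tendsto hρ).trans_isBigO hρ1).congr_left fun t => ?_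
        simp
      have h2 : (fun t => Real.log (pfEigenvalue (A t)) - t ^ 2 * σ) =o[𝓝 0] fun t => t ^ 2 :=
        (hlog.add key).congr_left fun t => by ring
      have h3 := (h2.mono (nhdsWithin_le_nhds (s := {0}ᶜ))).tendsto_div_nhds_zero.add_const σ
      rw [zero_add] at h3
      rw [mul_div_cancel_left₀ _ two_ne_zero]
      refine h3.congr' ?_
      filter_upwards [self_mem_nhdsWithin] with t ht
      have ht : t ≠ 0 := ht
      rw [hgauge]
      field_simp
      ring
    · intro i
      have hc : Tendsto (fun t : ℝ => 1 + t ^ 2 * k i) (𝓝 0) (𝓝 (1 + 0 ^ 2 * k i)) :=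
        Continuous.tendsto (by fun_prop) 0
      rw [zero_pow two_ne_zero, zero_mul, add_zero] at hc
      exact (hc.eventually_const_lt (u := 1 / 2) (by norm_num)).mono fun t ht => ht.le
    · intro i
      have e1 : ∀ j, (fun t : ℝ => P i j * ((Real.exp (t * F i j) - 1) * (t ^ 2 * k j) +
          (Real.exp (t * F i j) - 1 - t * F i j - t ^ 2 * F i j ^ 2 / 2))) =o[𝓝 0]
          fun t => t ^ 2 := fun j => by
        refine IsLittleO.const_mul_left (IsLittleO.add ?_ (hexp i j)) _
        have h0 : Tendsto (fun t : ℝ => t * F i j) (𝓝 0) (𝓝 0) := by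
          simpa using (continuous_id.mul_const (F i j)).tendsto 0
        have h1 : (fun t : ℝ => t ^ 2 * k j) =O[𝓝 0] fun t => t ^ 2 :=
          IsBigO.of_bound |k j| (Eventually.of_forall fun t => by
            rw [norm_mul, mul_comm, Real.norm_eq_abs (k j)])
        have := (hone_sub.comp_tendsto h0).mul_isBigO h1
        simpa [Function.comp_def] using this
      have e2 : (fun t : ℝ => t ^ 2 * (t ^ 2 * (σ * k i))) =o[𝓝 0] fun t => t ^ 2 := by
        have h1 : (fun t : ℝ => t ^ 2 * (σ * k i)) =o[𝓝 0] fun _ => (1 : ℝ) := by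
          rw [isLittleO_one_iff]
          have : Tendsto (fun t : ℝ => t ^ 2 * (σ * k i)) (𝓝 0) (𝓝 (0 ^ 2 * (σ * k i))) :=
            Continuous.tendsto (by fun_prop) 0
          simpa using this
        simpa using (isBigO_refl (fun t : ℝ => t ^ 2) (𝓝 0)).mul_isLittleO h1
      refine ((IsLittleO.sum fun j (_ : j ∈ Finset.univ) => e1 j).sub e2).congr_left fun t => ?_
      have e3 : ∑ j, P i j * (1 + t * F i j + t ^ 2 * (F i j ^ 2 / 2) + t ^ 2 * k j) =
          1 + t ^ 2 * (σ + k i) := by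
        have : ∑ j, P i j * (1 + t * F i j + t ^ 2 * (F i j ^ 2 / 2) + t ^ 2 * k j) =
            ∑ j, P i j + t * ∑ j, P i j * F i j + t ^ 2 * (Q i / 2)
              + t ^ 2 * ∑ j, P i j * k j := by
          simp only [hQ, Finset.sum_div, Finset.mul_sum, ← Finset.sum_add_distrib]
          exact Finset.sum_congr rfl fun j _ => by ring
        rw [this, hP1, hPF]
        linear_combination t ^ 2 * hk i
      have e4 : (A t *ᵥ fun j => 1 + t ^ 2 * k j) i =
          ∑ j, P i j * ((Real.exp (t * F i j) - 1) * (t ^ 2 * k j) +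
          (Real.exp (t * F i j) - 1 - t * F i j - t ^ 2 * F i j ^ 2 / 2)) +
          ∑ j, P i j * (1 + t * F i j + t ^ 2 * (F i j ^ 2 / 2) + t ^ 2 * k j) := by
        rw [← Finset.sum_add_distrib]
        exact Finset.sum_congr rfl fun j _ => by simp only [hA, of_apply]; ring
      rw [e4, e3, Finset.sum_apply]
      ring
  -- A zero stationary mean of squares, with positive weights, forces `F` to vanish on the support
  -- of `P`.
  · have hσz : σ = 0 := by linarith
    have h1 : (u ⬝ᵥ fun i => Q i / 2) = 0 := by
      rw [hσ, div_eq_zero_iff] at hσz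
      exact hσz.resolve_right huv.ne'
    have h2 := (Finset.sum_eq_zero_iff_of_nonneg fun i _ =>
      mul_nonneg (hu i).le (div_nonneg (hQ0 i) two_pos.le)).1 h1 i (Finset.mem_univ i)
    have h3 : Q i = 0 := by
      rcases mul_eq_zero.1 h2 with h2 | h2
      · exact absurd h2 (hu i).ne'
      · linarith
    have h4 := (Finset.sum_eq_zero_iff_of_nonneg fun j _ =>
      mul_nonneg (hP.nonneg i j) (sq_nonneg (F i j))).1 h3 j (Finset.mem_univ j)
    have h5 : F i j = 0 := by
      rcases mul_eq_zero.1 h4 with h4 | h4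
      · exact absurd h4 hij.ne'
      · exact pow_eq_zero_iff two_ne_zero |>.1 h4
    simp only [hF] at h5
    linarith

end Perturbation

end MarkovRenyi

/-! ### Convex functions of one variable and their secant slopes at zero -/

namespace MarkovRenyi

section OneVariable

lemma tendsto_neg_div_of_hasDerivAt {φ : ℝ → ℝ} {d : ℝ} (h0 : φ 0 = 0) (hd : HasDerivAt φ d 0) :
    Tendsto (fun t => -(1 / t) * φ t) (𝓝[≠] 0) (𝓝 (-d)) := by
  refine (hasDerivAt_iff_tendsto_slope.1 hd).neg.congr fun t => ?_
  rw [slope_def_field, h0]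
  ring

variable {φ h : ℝ → ℝ}

/-- Away from `0`, `h` is minus the slope of the secant of `φ` from the origin, and such slopes of a
convex function increase. The value at `0` is reached through the limit. -/
lemma antitoneOn_of_convexOn (hφ : ConvexOn ℝ (Ioi (-1)) φ)
    (hh : ∀ θ, -1 < θ → θ * h θ = -φ θ) (h0 : Tendsto h (𝓝[≠] 0) (𝓝 (h 0))) :
    AntitoneOn h (Ioi (-1)) := by
  have hφ0 : φ 0 = 0 := by simpa using hh 0 (by norm_num)
  have key : ∀ x y : ℝ, -1 < x → x ≤ y → x ≠ 0 → y ≠ 0 → h y ≤ h x := by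
    intro x y hx hxy hx0 hy0
    have h1 := hφ.secant_mono (a := 0) (by simp : (0 : ℝ) ∈ Ioi (-1)) (mem_Ioi.2 hx)
      (mem_Ioi.2 (hx.trans_le hxy)) hx0 hy0 hxy
    rw [hφ0, sub_zero, sub_zero, sub_zero, sub_zero, ← neg_neg (φ x), ← neg_neg (φ y), ← hh x hx,
      ← hh y (hx.trans_le hxy), neg_div, neg_div, mul_div_cancel_left₀ _ hx0,
      mul_div_cancel_left₀ _ hy0] at h1
    linarith
  intro x hx y hy hxy
  have hx : -1 < x := hx
  rcases eq_or_lt_of_le hxy with rfl | hxy'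
  · exact le_rfl
  rcases eq_or_ne x 0 with rfl | hx0
  · refine ge_of_tendsto (h0.mono_left (nhdsGT_le_nhdsNE 0)) ?_
    filter_upwards [Ioo_mem_nhdsGT hxy'] with t ht
    exact key t y (by linarith [ht.1]) ht.2.le ht.1.ne' hxy'.ne'
  rcases eq_or_ne y 0 with rfl | hy0
  · refine le_of_tendsto (h0.mono_left (nhdsLT_le_nhdsNE 0)) ?_
    filter_upwards [Ioo_mem_nhdsLT hxy'] with t ht
    exact key x t hx ht.1.le hx0 ht.2.ne
  · exact key x y hx hxy hx0 hy0

lemma strictAntiOn_of_strictConvexOn (hφ : StrictConvexOn ℝ (Ioi (-1)) φ)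
    (hh : ∀ θ, -1 < θ → θ * h θ = -φ θ) (h0 : Tendsto h (𝓝[≠] 0) (𝓝 (h 0))) :
    StrictAntiOn h (Ioi (-1)) := by
  have hφ0 : φ 0 = 0 := by simpa using hh 0 (by norm_num)
  have hanti := antitoneOn_of_convexOn hφ.convexOn hh h0
  have key : ∀ x y : ℝ, -1 < x → x < y → x ≠ 0 → y ≠ 0 → h y < h x := by
    intro x y hx hxy hx0 hy0
    have h1 := hφ.secant_strict_mono (a := 0) (by simp : (0 : ℝ) ∈ Ioi (-1)) (mem_Ioi.2 hx)
      (mem_Ioi.2 (hx.trans hxy)) hx0 hy0 hxy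
    rw [hφ0, sub_zero, sub_zero, sub_zero, sub_zero, ← neg_neg (φ x), ← neg_neg (φ y), ← hh x hx,
      ← hh y (hx.trans hxy), neg_div, neg_div, mul_div_cancel_left₀ _ hx0,
      mul_div_cancel_left₀ _ hy0] at h1
    linarith
  intro x hx y hy hxy
  have hx : -1 < x := hx
  rcases eq_or_ne x 0 with rfl | hx0
  -- Passing through `0` by a limit loses strictness, so an intermediate point is inserted.
  · exact (key (y / 2) y (by linarith) (by linarith) (by linarith) (by linarith)).trans_le
      (hanti (mem_Ioi.2 hx) (mem_Ioi.2 (by linarith)) (by linarith))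
  rcases eq_or_ne y 0 with rfl | hy0
  · exact (hanti (mem_Ioi.2 (by linarith : -1 < x / 2)) (mem_Ioi.2 (by linarith))
      (by linarith)).trans_lt (key x (x / 2) hx (by linarith) hx0 (by linarith))
  · exact key x y hx hxy hx0 hy0

/-- The family of equivalences shared by all the entropies on `(-1, ∞)`. -/
lemma concave_antitone_Ioi {p : Prop} (hφ : ConvexOn ℝ (Ioi (-1)) φ)
    (hh : ∀ θ, -1 < θ → θ * h θ = -φ θ) (h0 : Tendsto h (𝓝[≠] 0) (𝓝 (h 0)))
    (hstrict : p → StrictConvexOn ℝ (Ioi (-1)) φ)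
    (haff : ¬p → ∃ c : ℝ, ∀ θ, -1 < θ → φ θ = θ * c) :
    ConcaveOn ℝ (Ioi (-1)) (fun θ => θ * h θ) ∧
      (StrictConcaveOn ℝ (Ioi (-1)) (fun θ => θ * h θ) ↔ p) ∧
      AntitoneOn h (Ioi (-1)) ∧ (StrictAntiOn h (Ioi (-1)) ↔ p) := by
  have hEq : EqOn (fun θ => θ * h θ) (-φ) (Ioi (-1)) := fun θ hθ => hh θ hθ
  refine ⟨hφ.neg.congr hEq.symm, ⟨fun hs => ?_, fun hp => (hstrict hp).neg.congr hEq.symm⟩,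
    antitoneOn_of_convexOn hφ hh h0,
    ⟨fun hs => ?_, fun hp => strictAntiOn_of_strictConvexOn (hstrict hp) hh h0⟩⟩
  -- For linear `φ`, the function `θ * h θ` is linear and strict concavity fails at `2`, the
  -- midpoint of `1` and `3`; likewise `h 1 = h 2` below.
  · by_contra hp
    obtain ⟨c, hc⟩ := haff hp
    have h1 := hs.2 (mem_Ioi.2 (by norm_num : (-1 : ℝ) < 1)) (mem_Ioi.2 (by norm_num : (-1 : ℝ) < 3))
      (by norm_num) (one_half_pos : (0 : ℝ) < 1 / 2) (one_half_pos : (0 : ℝ) < 1 / 2)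
      (by norm_num)
    norm_num at h1
    have e1 := hh 1 (by norm_num)
    have e2 := hh 2 (by norm_num)
    have e3 := hh 3 (by norm_num)
    rw [hc _ (by norm_num)] at e1 e2 e3
    linarith
  · by_contra hp
    obtain ⟨c, hc⟩ := haff hp
    have h1 := hs (a := 1) (b := 2) (mem_Ioi.2 (by norm_num)) (mem_Ioi.2 (by norm_num))
      (by norm_num)
    have e1 := hh 1 (by norm_num)
    have e2 := hh 2 (by norm_num)
    rw [hc _ (by norm_num)] at e1 e2
    linarith

/-- A monotone function bounded above has a one-sided limit. For `θ ≤ -1 / 2` the bound on `φ` gives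
`h θ ≤ 2 * |C|`; beyond that monotonicity suffices. -/
lemma exists_tendsto_nhdsGT_neg_one {C : ℝ} (hφ : ConvexOn ℝ (Ioi (-1)) φ)
    (hh : ∀ θ, -1 < θ → θ * h θ = -φ θ) (h0 : Tendsto h (𝓝[≠] 0) (𝓝 (h 0)))
    (hC : ∀ θ, -1 < θ → θ < 0 → φ θ ≤ C) : ∃ L, Tendsto h (𝓝[>] (-1)) (𝓝 L) := by
  have hanti := antitoneOn_of_convexOn hφ hh h0
  have h1 : Tendsto h (𝓝[>] (-1)) (𝓝 (sSup (h '' Ioo (-1) 0))) := by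
    refine AntitoneOn.tendsto_nhdsWithin_Ioo_right (nonempty_Ioo.2 (by norm_num))
      (hanti.mono fun x hx => hx.1) ⟨2 * |C| + |h (-1 / 2)|, ?_⟩
    rintro _ ⟨θ, ⟨h1, h2⟩, rfl⟩
    have h3 := le_abs_self C
    have h4 := le_abs_self (h (-1 / 2))
    have h5 := abs_nonneg C
    have h6 := abs_nonneg (h (-1 / 2))
    rcases le_total θ (-1 / 2) with h7 | h7
    · have h8 := hC θ h1 h2
      have h9 := hh θ h1
      by_contra h10
      push Not at h10
      nlinarith
    · have := hanti (mem_Ioi.2 (by norm_num : (-1 : ℝ) < -1 / 2)) (mem_Ioi.2 h1) h7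
      linarith
  exact ⟨_, h1⟩

/-- Shift both points by `ε > 0` into the open half-line and let `ε` tend to `0`; in the interior,
concavity supplies continuity. -/
lemma concaveOn_Ici_of_Ioi {F : ℝ → ℝ} {a : ℝ} (hF : ConcaveOn ℝ (Ioi a) F)
    (ha : Tendsto F (𝓝[>] a) (𝓝 (F a))) : ConcaveOn ℝ (Ici a) F := by
  have hcont : ∀ x, a ≤ x → Tendsto (fun ε => F (x + ε)) (𝓝[>] 0) (𝓝 (F x)) := by
    intro x hx
    have hadd : Tendsto (fun ε : ℝ => x + ε) (𝓝[>] 0) (𝓝[>] x) := by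
      refine tendsto_nhdsWithin_iff.2 ⟨?_, ?_⟩
      · have : Tendsto (fun ε : ℝ => x + ε) (𝓝 0) (𝓝 (x + 0)) :=
          Continuous.tendsto (by fun_prop) 0
        rw [add_zero] at this
        exact this.mono_left nhdsWithin_le_nhds
      · filter_upwards [self_mem_nhdsWithin] with ε hε
        have : 0 < ε := hε
        exact mem_Ioi.2 (by linarith)
    rcases eq_or_lt_of_le hx with rfl | hx
    · exact ha.comp hadd
    · have h1 : ContinuousAt F x :=
        (hF.continuousOn isOpen_Ioi).continuousAt (isOpen_Ioi.mem_nhds hx)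
      exact (h1.tendsto.mono_left nhdsWithin_le_nhds).comp hadd
  refine ⟨convex_Ici a, fun x hx y hy α β hα hβ hαβ => ?_⟩
  have hx : a ≤ x := hx
  have hy : a ≤ y := hy
  have hz : a ≤ α • x + β • y := convex_Ici a hx hy hα hβ hαβ
  refine le_of_tendsto_of_tendsto (((hcont x hx).const_smul α).add ((hcont y hy).const_smul β))
    (hcont _ hz) ?_
  filter_upwards [self_mem_nhdsWithin] with ε hε
  have hε : 0 < ε := hε
  have h1 := hF.2 (mem_Ioi.2 (by linarith : a < x + ε)) (mem_Ioi.2 (by linarith : a < y + ε))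
    hα hβ hαβ
  have h2 : α • (x + ε) + β • (y + ε) = α • x + β • y + ε := by
    simp only [smul_eq_mul]
    linear_combination ε * hαβ
  rwa [h2] at h1

lemma strictConcaveOn_Ici_of_Ioi {F : ℝ → ℝ} {a : ℝ} (hF : StrictConcaveOn ℝ (Ioi a) F)
    (ha : Tendsto F (𝓝[>] a) (𝓝 (F a))) : StrictConcaveOn ℝ (Ici a) F := by
  have hF' := concaveOn_Ici_of_Ioi hF.concaveOn ha
  refine LinearOrder.strictConcaveOn_of_lt (convex_Ici a) fun x hx y hy hxy α β hα hβ hαβ => ?_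
  have hx : a ≤ x := hx
  simp only [smul_eq_mul]
  set z := α * x + β * y with hz
  obtain rfl : β = 1 - α := by linarith
  have hxz : x < z := by nlinarith
  have hzy : z < y := by nlinarith
  -- The endpoint `x` is replaced by the midpoint of `x` and `z`, which is interior. The weights
  -- below are those expressing `z` through this midpoint and `y`.
  have h1 := hF'.2 (mem_Ici.2 hx) (mem_Ici.2 (by linarith : a ≤ z))
    (one_half_pos : (0 : ℝ) < 1 / 2).le (one_half_pos : (0 : ℝ) < 1 / 2).le (by norm_num)
  have h2 := hF.2 (mem_Ioi.2 (by linarith : a < 1 / 2 * x + 1 / 2 * z))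
    (mem_Ioi.2 (by linarith : a < y)) (by intro h; linarith)
    (by positivity : 0 < 2 * α / (1 + α)) (by positivity : 0 < (1 - α) / (1 + α))
    (by field_simp; ring)
  simp only [smul_eq_mul] at h1 h2
  have h3 : 2 * α / (1 + α) * (1 / 2 * x + 1 / 2 * z) + (1 - α) / (1 + α) * y = z := by
    field_simp
    rw [hz]
    ring
  rw [h3] at h2
  have h4 : 0 < 1 + α := by linarith
  have h5 : (2 * α * F (1 / 2 * x + 1 / 2 * z) + (1 - α) * F y) < (1 + α) * F z := by
    have := mul_lt_mul_of_pos_left h2 h4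
    have e : (1 + α) * (2 * α / (1 + α) * F (1 / 2 * x + 1 / 2 * z) + (1 - α) / (1 + α) * F y) =
      2 * α * F (1 / 2 * x + 1 / 2 * z) + (1 - α) * F y := by field_simp
    rwa [e] at this
  nlinarith

/-- The family of equivalences shared by the one-parameter entropies on `[-1, ∞)`. -/
lemma concave_antitone_Ici {p : Prop} (hφ : ConvexOn ℝ (Ioi (-1)) φ)
    (hh : ∀ θ, -1 < θ → θ * h θ = -φ θ) (h0 : Tendsto h (𝓝[≠] 0) (𝓝 (h 0)))
    (h1 : Tendsto h (𝓝[>] (-1)) (𝓝 (h (-1))))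
    (hstrict : p → StrictConvexOn ℝ (Ioi (-1)) φ)
    (haff : ¬p → ∃ c : ℝ, ∀ θ, -1 < θ → φ θ = θ * c) :
    ConcaveOn ℝ (Ici (-1)) (fun θ => θ * h θ) ∧
      (StrictConcaveOn ℝ (Ici (-1)) (fun θ => θ * h θ) ↔ p) ∧
      AntitoneOn h (Ici (-1)) ∧ (StrictAntiOn h (Ici (-1)) ↔ p) := by
  obtain ⟨k1, k2, k3, k4⟩ := concave_antitone_Ioi hφ hh h0 hstrict haff
  have h1' : Tendsto (fun θ => θ * h θ) (𝓝[>] (-1)) (𝓝 (-1 * h (-1))) :=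
    (tendsto_id.mono_left nhdsWithin_le_nhds).mul h1
  have hend : ∀ y, -1 < y → h y ≤ h (-1) := fun y hy => by
    refine ge_of_tendsto h1 ?_
    filter_upwards [Ioo_mem_nhdsGT hy] with t ht
    exact k3 (mem_Ioi.2 ht.1) (mem_Ioi.2 hy) ht.2.le
  refine ⟨concaveOn_Ici_of_Ioi k1 h1', ⟨fun hs => k2.1 (hs.subset Ioi_subset_Ici_self
    (convex_Ioi _)), fun hp => strictConcaveOn_Ici_of_Ioi (k2.2 hp) h1'⟩, ?_,
    ⟨fun hs => k4.1 (hs.mono Ioi_subset_Ici_self), fun hp => ?_⟩⟩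
  · intro x hx y hy hxy
    rcases eq_or_lt_of_le hxy with rfl | hxy'
    · exact le_rfl
    rcases eq_or_lt_of_le (mem_Ici.1 hx) with rfl | hx'
    · exact hend y hxy'
    · exact k3 hx' (hx'.trans hxy') hxy
  · intro x hx y hy hxy
    rcases eq_or_lt_of_le (mem_Ici.1 hx) with rfl | hx'
    · exact (k4.2 hp (mem_Ioi.2 (by linarith : -1 < (-1 + y) / 2)) (mem_Ioi.2 hxy)
        (by linarith)).trans_le (hend _ (by linarith))
    · exact k4.2 hp hx' (hx'.trans hxy) hxy

end OneVariable

end MarkovRenyi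

/-! ### The lower entropy and the conditional variance -/

namespace MarkovRenyi

section Lower

open Matrix

variable {X Y : Type*} [Fintype X] [DecidableEq X] [Fintype Y] [DecidableEq Y] [Nonempty X]
  {W : Matrix (X × Y) (X × Y) ℝ}

lemma pfEigenvalue_eq_one_of_colStochastic {n : Type*} [Fintype n] [DecidableEq n] [Nonempty n]
    {A : Matrix n n ℝ} (hA : A ∈ Matrix.colStochastic ℝ n) (hirr : A.IsIrreducible) :
    pfEigenvalue A = 1 :=
  pfEigenvalue_eq_of_vecMul hirr (u := 1) (fun _ => one_pos) (by rw [hA.2, one_smul])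

lemma marginal_nonneg (hW : ∀ s s', 0 ≤ W s s') (y y' : Y) : 0 ≤ marginal W y y' :=
  Finset.sum_nonneg fun _ _ => hW _ _

lemma sum_eq_marginal (nh : NonHidden W) (x' : X) (y y' : Y) :
    ∑ x, W (x, y) (x', y') = marginal W y y' := nh y y' _ _

lemma marginal_pos (hW : ∀ s s', 0 ≤ W s s') (nh : NonHidden W) {s s' : X × Y}
    (h : 0 < W s s') : 0 < marginal W s.2 s'.2 := by
  rw [← sum_eq_marginal nh s'.1]
  exact lt_of_lt_of_le h (Finset.single_le_sum (f := fun x => W (x, s.2) (s'.1, s'.2))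
    (fun _ _ => hW _ _) (Finset.mem_univ s.1))

lemma marginal_isIrreducible (hirr : W.IsIrreducible) (nh : NonHidden W) :
    (marginal W).IsIrreducible :=
  isIrreducible_of_map Prod.snd Prod.snd_surjective hirr (marginal_nonneg hirr.nonneg)
    fun _ _ h => marginal_pos hirr.nonneg nh h

lemma marginal_mem_colStochastic (hW : W ∈ Matrix.colStochastic ℝ (X × Y)) :
    marginal W ∈ Matrix.colStochastic ℝ Y := by
  rw [Matrix.mem_colStochastic_iff_sum] at hW ⊢
  refine ⟨marginal_nonneg hW.1, fun y' => ?_⟩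
  rw [← hW.2 (Classical.arbitrary X, y'), Fintype.sum_prod_type_right]
  rfl

/-- The information increment `log W(x, y | x', y') - log W(y | y')`. -/
noncomputable def increment (W : Matrix (X × Y) (X × Y) ℝ) (s s' : X × Y) : ℝ :=
  Real.log (W s s') - Real.log (marginal W s.2 s'.2)

/-- Exhibits the family as an exponential tilt of `W`. The condition `θ > -1` makes the zero entries
agree. -/
lemma tilted_eq (hW : ∀ s s', 0 ≤ W s s') (nh : NonHidden W) {θ : ℝ} (hθ : -1 < θ)
    (s s' : X × Y) : tilted W θ s s' = W s s' * Real.exp (θ * increment W s s') := by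
  simp only [tilted, of_apply]
  rcases eq_or_lt_of_le (hW s s') with h | h
  · rw [← h, Real.zero_rpow (by linarith), zero_mul, zero_mul]
  · have hM := marginal_pos hW nh h
    rw [Real.rpow_add h, Real.rpow_one, Real.rpow_def_of_pos h, Real.rpow_def_of_pos hM, mul_assoc,
      ← Real.exp_add, increment]
    congr 2
    ring

lemma tilted_isIrreducible (hirr : W.IsIrreducible) (nh : NonHidden W) {θ : ℝ} (hθ : -1 < θ) :
    (tilted W θ).IsIrreducible :=
  isIrreducible_of_pos hirr
    (fun s s' => by
      rw [tilted_eq hirr.nonneg nh hθ]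
      exact mul_nonneg (hirr.nonneg s s') (Real.exp_pos _).le)
    fun s s' h => by
      rw [tilted_eq hirr.nonneg nh hθ]
      exact mul_pos h (Real.exp_pos _)

/-- The information increment is a constant plus a coboundary. -/
def IsCoboundary (W : Matrix (X × Y) (X × Y) ℝ) : Prop :=
  ∃ (c : ℝ) (g : X × Y → ℝ), ∀ s s', 0 < W s s' → increment W s s' = c + g s - g s'

variable [Nonempty Y]

lemma pfEigenvalue_tilted_zero (hW : W ∈ Matrix.colStochastic ℝ (X × Y))
    (hirr : W.IsIrreducible) (nh : NonHidden W) : pfEigenvalue (tilted W 0) = 1 := by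
  have : tilted W 0 = W := by
    ext s s'
    rw [tilted_eq hirr.nonneg nh (by norm_num)]
    simp
  rw [this, pfEigenvalue_eq_one_of_colStochastic hW hirr]

lemma tilted_convex_combination (hirr : W.IsIrreducible) (nh : NonHidden W) {θ₁ θ₂ a b : ℝ}
    (h₁ : -1 < θ₁) (h₂ : -1 < θ₂) (ha : 0 < a) (hb : 0 < b) (hab : a + b = 1) (s s' : X × Y) :
    tilted W (a * θ₁ + b * θ₂) s s' = tilted W θ₁ s s' ^ a * tilted W θ₂ s s' ^ b := by
  rw [tilted_eq hirr.nonneg nh (by nlinarith), tilted_eq hirr.nonneg nh h₁,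
    tilted_eq hirr.nonneg nh h₂, Real.mul_rpow (hirr.nonneg s s') (Real.exp_pos _).le,
    Real.mul_rpow (hirr.nonneg s s') (Real.exp_pos _).le, ← Real.exp_mul, ← Real.exp_mul,
    mul_mul_mul_comm, ← Real.exp_add, ← Real.rpow_add' (hirr.nonneg s s') (by rw [hab]; norm_num),
    hab, Real.rpow_one]
  congr 2
  ring

lemma convexOn_log_tilted (hirr : W.IsIrreducible) (nh : NonHidden W) :
    ConvexOn ℝ (Ioi (-1)) fun θ => Real.log (pfEigenvalue (tilted W θ)) := by
  refine convexOn_iff_forall_pos.2 ⟨convex_Ioi _, fun θ₁ h₁ θ₂ h₂ a b ha hb hab => ?_⟩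
  have h₁ : -1 < θ₁ := h₁
  have h₂ : -1 < θ₂ := h₂
  simp only [smul_eq_mul]
  exact log_pfEigenvalue_le (tilted_isIrreducible hirr nh h₁) (tilted_isIrreducible hirr nh h₂)
    (tilted_isIrreducible hirr nh (by nlinarith)) ha hb hab fun s s' =>
      (tilted_convex_combination hirr nh h₁ h₂ ha hb hab s s').le

/-- Equality would make the tilts at `θ₁` and `θ₂` gauge equivalent. Their entries differ by the
factor `exp ((θ₁ - θ₂) * increment)`, so dividing the gauge by `θ₁ - θ₂` exhibits the increment as a
coboundary. -/
lemma strictConvexOn_log_tilted (hirr : W.IsIrreducible) (nh : NonHidden W)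
    (hc : ¬IsCoboundary W) :
    StrictConvexOn ℝ (Ioi (-1)) fun θ => Real.log (pfEigenvalue (tilted W θ)) := by
  refine ⟨convex_Ioi _, fun θ₁ h₁ θ₂ h₂ hne a b ha hb hab => ?_⟩
  refine lt_of_le_of_ne ((convexOn_log_tilted hirr nh).2 h₁ h₂ ha.le hb.le hab) fun heq => hc ?_
  have h₁ : -1 < θ₁ := h₁
  have h₂ : -1 < θ₂ := h₂
  simp only [smul_eq_mul] at heq
  obtain ⟨-, c, g, hg⟩ := gauge_of_log_pfEigenvalue_eq (tilted_isIrreducible hirr nh h₁)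
    (tilted_isIrreducible hirr nh h₂) (tilted_isIrreducible hirr nh (by nlinarith)) ha hb hab
    (fun s s' => (tilted_convex_combination hirr nh h₁ h₂ ha hb hab s s').le) heq
  have hsub : θ₁ - θ₂ ≠ 0 := sub_ne_zero.2 hne
  refine ⟨c / (θ₁ - θ₂), fun s => g s / (θ₁ - θ₂), fun s s' h => ?_⟩
  have h3 := hg s s'
  rw [tilted_eq hirr.nonneg nh h₁, tilted_eq hirr.nonneg nh h₂, mul_left_comm,
    ← Real.exp_add] at h3
  have h4 := Real.exp_injective (mul_left_cancel₀ h.ne' h3)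
  field_simp
  linarith

lemma log_tilted_eq_of_isCoboundary (hW : W ∈ Matrix.colStochastic ℝ (X × Y))
    (hirr : W.IsIrreducible) (nh : NonHidden W) (hc : IsCoboundary W) :
    ∃ c : ℝ, ∀ θ, -1 < θ → Real.log (pfEigenvalue (tilted W θ)) = θ * c := by
  obtain ⟨c, g, hg⟩ := hc
  refine ⟨c, fun θ hθ => ?_⟩
  rw [pfEigenvalue_gauge (tilted_isIrreducible hirr nh hθ) hirr (θ * c) (fun s => θ * g s)
    fun s s' => ?_, pfEigenvalue_eq_one_of_colStochastic hW hirr, mul_one, Real.log_exp]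
  rw [tilted_eq hirr.nonneg nh hθ, mul_comm]
  rcases eq_or_lt_of_le (hirr.nonneg s s') with h | h
  · rw [← h, mul_zero, mul_zero]
  · rw [hg s s' h]
    congr 2
    ring

/-- Provides the bound, uniform up to `-1`, that makes the limit of the entropy there finite: for
`-1 < θ < 0` both exponents are nonnegative, so all entries are at most `1`. -/
lemma log_tilted_le (hW : W ∈ Matrix.colStochastic ℝ (X × Y)) (hirr : W.IsIrreducible)
    (nh : NonHidden W) {θ : ℝ} (h₁ : -1 < θ) (h₂ : θ < 0) :
    Real.log (pfEigenvalue (tilted W θ)) ≤ Real.log (Fintype.card (X × Y)) := by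
  refine Real.log_le_log (pfEigenvalue_pos (tilted_isIrreducible hirr nh h₁))
    (pfEigenvalue_le (tilted_isIrreducible hirr nh h₁) (w := 1) (fun _ => one_pos) fun s => ?_)
  have : ∀ s', tilted W θ s s' ≤ 1 := fun s' => mul_le_one₀
    (Real.rpow_le_one (hirr.nonneg s s') (Matrix.le_one_of_mem_colStochastic hW) (by linarith))
    (Real.rpow_nonneg (marginal_nonneg hirr.nonneg _ _) _)
    (Real.rpow_le_one (marginal_nonneg hirr.nonneg _ _)
      (Matrix.le_one_of_mem_colStochastic (marginal_mem_colStochastic hW)) (by linarith))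
  simp only [mulVec, dotProduct, Pi.one_apply, mul_one]
  refine (Finset.sum_le_sum fun s' _ => this s').trans_eq ?_
  simp

lemma lowerEntropy_of_ne {θ : ℝ} (h0 : θ ≠ 0) (h1 : θ ≠ -1) :
    lowerEntropy W θ = -(1 / θ) * Real.log (pfEigenvalue (tilted W θ)) := by
  simp [lowerEntropy, h0, h1]

lemma eventually_ne_neg_one : ∀ᶠ t : ℝ in 𝓝[≠] 0, t ≠ -1 :=
  nhdsWithin_le_nhds (isOpen_ne.mem_nhds (by norm_num))

lemma eventually_ne_zero_nhdsGT : ∀ᶠ t : ℝ in 𝓝[>] (-1), t ≠ 0 :=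
  nhdsWithin_le_nhds (isOpen_ne.mem_nhds (by norm_num))

lemma eventually_gt_neg_one : ∀ᶠ t : ℝ in 𝓝 0, -1 < t :=
  isOpen_Ioi.mem_nhds (by norm_num)

/-- The first two derivatives of `θ ↦ log ρ(tilted θ)` at `0`. -/
lemma exists_expansion_tilted (hW : W ∈ Matrix.colStochastic ℝ (X × Y))
    (hirr : W.IsIrreducible) (nh : NonHidden W) :
    ∃ m V : ℝ, 0 ≤ V ∧ HasDerivAt (fun θ => Real.log (pfEigenvalue (tilted W θ))) m 0 ∧
      Tendsto (fun θ => (Real.log (pfEigenvalue (tilted W θ)) - θ * m) / θ ^ 2) (𝓝[≠] 0)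
        (𝓝 (V / 2)) ∧ (V = 0 → IsCoboundary W) := by
  -- The expansion is for row-stochastic matrices, while `W` is column-stochastic; transposing keeps
  -- the eigenvalue and flips the sign of the coboundary.
  obtain ⟨m, V, hV, ht, hV0⟩ := exists_tendsto_log_pfEigenvalue_exp hirr.transpose
    (fun s' => Matrix.sum_col_of_mem_colStochastic hW s') fun s' s => increment W s s'
  have ht' : Tendsto (fun θ => (Real.log (pfEigenvalue (tilted W θ)) - θ * m) / θ ^ 2) (𝓝[≠] 0)
      (𝓝 (V / 2)) := by
    refine ht.congr' ?_
    filter_upwards [nhdsWithin_le_nhds eventually_gt_neg_one] with θ hθ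
    rw [← pfEigenvalue_transpose (tilted_isIrreducible hirr nh hθ)]
    congr 4
    ext s' s
    simp [tilted_eq hirr.nonneg nh hθ]
  refine ⟨m, V, hV, ?_, ht', fun h => ?_⟩
  · rw [hasDerivAt_iff_tendsto_slope]
    have h1 : Tendsto (fun θ : ℝ => θ) (𝓝[≠] 0) (𝓝 0) := tendsto_id.mono_left nhdsWithin_le_nhds
    have h2 := (h1.mul ht').add_const m
    rw [zero_mul, zero_add] at h2
    refine h2.congr' ?_
    filter_upwards [self_mem_nhdsWithin] with θ hθ
    have hθ : θ ≠ 0 := hθ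
    rw [slope_def_field, pfEigenvalue_tilted_zero hW hirr nh, Real.log_one]
    field_simp
    ring
  · obtain ⟨g, hg⟩ := hV0 h
    exact ⟨m, fun s => -g s, fun s s' hs => by rw [hg s' s hs]; ring⟩

lemma tendsto_lowerEntropy_zero (hW : W ∈ Matrix.colStochastic ℝ (X × Y))
    (hirr : W.IsIrreducible) (nh : NonHidden W) {m : ℝ}
    (hm : HasDerivAt (fun θ => Real.log (pfEigenvalue (tilted W θ))) m 0) :
    lowerEntropy W 0 = -m ∧ Tendsto (lowerEntropy W) (𝓝[≠] 0) (𝓝 (-m)) := by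
  have h1 := tendsto_neg_div_of_hasDerivAt
    (by rw [pfEigenvalue_tilted_zero hW hirr nh, Real.log_one]) hm
  refine ⟨?_, h1.congr' ?_⟩
  · simp only [lowerEntropy, if_true]
    exact h1.limUnder_eq
  · filter_upwards [self_mem_nhdsWithin, eventually_ne_neg_one] with t ht ht'
    rw [lowerEntropy_of_ne ht ht']

lemma mul_lowerEntropy (hW : W ∈ Matrix.colStochastic ℝ (X × Y)) (hirr : W.IsIrreducible)
    (nh : NonHidden W) (θ : ℝ) (hθ : -1 < θ) :
    θ * lowerEntropy W θ = -Real.log (pfEigenvalue (tilted W θ)) := by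
  rcases eq_or_ne θ 0 with rfl | h0
  · rw [pfEigenvalue_tilted_zero hW hirr nh]
    simp
  · rw [lowerEntropy_of_ne h0 hθ.ne']
    field_simp

lemma tendsto_lowerEntropy_neg_one (hW : W ∈ Matrix.colStochastic ℝ (X × Y))
    (hirr : W.IsIrreducible) (nh : NonHidden W)
    (h0 : Tendsto (lowerEntropy W) (𝓝[≠] 0) (𝓝 (lowerEntropy W 0))) :
    Tendsto (lowerEntropy W) (𝓝[>] (-1)) (𝓝 (lowerEntropy W (-1))) := by
  obtain ⟨L, hL⟩ := exists_tendsto_nhdsGT_neg_one (convexOn_log_tilted hirr nh)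
    (mul_lowerEntropy hW hirr nh) h0 (fun θ => log_tilted_le hW hirr nh)
  have hL' : Tendsto (fun t => -(1 / t) * Real.log (pfEigenvalue (tilted W t))) (𝓝[>] (-1))
      (𝓝 L) := by
    refine hL.congr' ?_
    filter_upwards [self_mem_nhdsWithin, eventually_ne_zero_nhdsGT] with t ht ht'
    rw [lowerEntropy_of_ne ht' (ne_of_gt ht)]
  have : lowerEntropy W (-1) = L := by
    simp only [lowerEntropy, if_true]
    rw [if_neg (by norm_num)]
    exact hL'.limUnder_eq
  rwa [this]

/-- The variance quotient is twice the second-order remainder of `log ρ` over `θ ^ 2`, hence tends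
to the asymptotic variance. In the coboundary case `log ρ` is linear near `0` and the remainder
vanishes. -/
lemma condVariance_spec (hW : W ∈ Matrix.colStochastic ℝ (X × Y))
    (hirr : W.IsIrreducible) (nh : NonHidden W) :
    Tendsto (varianceQuotient W) (𝓝[≠] 0) (𝓝 (condVariance W)) ∧
      (0 < condVariance W ↔ ¬IsCoboundary W) := by
  obtain ⟨m, V, hV, hm, ht, hV0⟩ := exists_expansion_tilted hW hirr nh
  obtain ⟨e0, -⟩ := tendsto_lowerEntropy_zero hW hirr nh hm
  have hq : Tendsto (varianceQuotient W) (𝓝[≠] 0) (𝓝 V) := by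
    have h1 := ht.const_mul 2
    rw [mul_div_cancel₀ _ two_ne_zero] at h1
    refine h1.congr' ?_
    filter_upwards [self_mem_nhdsWithin, eventually_ne_neg_one] with t ht ht'
    have ht : t ≠ 0 := ht
    rw [varianceQuotient, condEntropy, e0, lowerEntropy_of_ne ht ht']
    field_simp
    ring
  have hVeq : condVariance W = V := hq.limUnder_eq
  rw [hVeq]
  refine ⟨hq, fun hpos hc => ?_, fun hc => lt_of_le_of_ne hV fun h => hc (hV0 h.symm)⟩
  obtain ⟨c, hc⟩ := log_tilted_eq_of_isCoboundary hW hirr nh hc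
  have hev : (fun θ => Real.log (pfEigenvalue (tilted W θ))) =ᶠ[𝓝 0] fun θ => θ * c := by
    filter_upwards [eventually_gt_neg_one] with θ hθ using hc θ hθ
  have hmc : m = c := (hm.congr_of_eventuallyEq hev.symm).unique (hasDerivAt_mul_const c)
  have h0 : Tendsto (fun θ => (Real.log (pfEigenvalue (tilted W θ)) - θ * m) / θ ^ 2) (𝓝[≠] 0)
      (𝓝 0) := by
    refine tendsto_const_nhds.congr' ?_
    filter_upwards [hev.filter_mono nhdsWithin_le_nhds] with θ hθ
    rw [hθ, hmc, sub_self, zero_div]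
  have := tendsto_nhds_unique ht h0
  linarith

end Lower

end MarkovRenyi

/-! ### Convexity on `Y` for strongly non-hidden matrices -/

namespace MarkovRenyi

section Upper

open Matrix

variable {X Y : Type*} [Fintype X] [DecidableEq X] [Fintype Y] [DecidableEq Y] [Nonempty X]
  {W : Matrix (X × Y) (X × Y) ℝ}

lemma StronglyNonHidden.nonHidden (snh : StronglyNonHidden W) : NonHidden W := fun y y' x₁ x₂ => by
  simpa using snh 0 (by norm_num) y y' x₁ x₂

lemma powerMarginal_zero : powerMarginal W 0 = marginal W := by
  ext y y'
  simp [powerMarginal, marginal]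

lemma sum_eq_powerMarginal (snh : StronglyNonHidden W) {θ : ℝ} (hθ : -1 < θ) (x' : X) (y y' : Y) :
    ∑ x, W (x, y) (x', y') ^ (1 + θ) = powerMarginal W θ y y' := snh θ hθ y y' _ _

lemma rpow_one_add_eq {w θ : ℝ} (hw : 0 ≤ w) (hθ : -1 < θ) :
    w ^ (1 + θ) = w * Real.exp (θ * Real.log w) := by
  rcases eq_or_lt_of_le hw with h | h
  · rw [← h, Real.zero_rpow (by linarith), zero_mul]
  · rw [Real.rpow_add h, Real.rpow_one, Real.rpow_def_of_pos h, mul_comm θ]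

lemma powerMarginal_eq (hW : ∀ s s', 0 ≤ W s s') {θ : ℝ} (hθ : -1 < θ) (y y' : Y) :
    powerMarginal W θ y y' = ∑ x, W (x, y) (Classical.arbitrary X, y') *
      Real.exp (θ * Real.log (W (x, y) (Classical.arbitrary X, y'))) :=
  Finset.sum_congr rfl fun _ _ => rpow_one_add_eq (hW _ _) hθ

lemma powerMarginal_nonneg (hW : ∀ s s', 0 ≤ W s s') (θ : ℝ) (y y' : Y) :
    0 ≤ powerMarginal W θ y y' :=
  Finset.sum_nonneg fun _ _ => Real.rpow_nonneg (hW _ _) _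

lemma powerMarginal_pos (hW : ∀ s s', 0 ≤ W s s') (θ : ℝ) {y y' : Y}
    (h : 0 < marginal W y y') : 0 < powerMarginal W θ y y' := by
  obtain ⟨x, -, hx⟩ := Finset.exists_lt_of_sum_lt (s := Finset.univ) (f := fun _ => (0 : ℝ))
    (g := fun x => W (x, y) (Classical.arbitrary X, y')) (by
      rw [Finset.sum_const_zero]; exact h)
  exact lt_of_lt_of_le (Real.rpow_pos_of_pos hx _)
    (Finset.single_le_sum (f := fun x => W (x, y) (Classical.arbitrary X, y') ^ (1 + θ))
      (fun _ _ => Real.rpow_nonneg (hW _ _) _) (Finset.mem_univ x))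

lemma eq_zero_of_marginal_eq_zero (hW : ∀ s s', 0 ≤ W s s') {y y' : Y}
    (h : marginal W y y' = 0) (x : X) : W (x, y) (Classical.arbitrary X, y') = 0 :=
  (Finset.sum_eq_zero_iff_of_nonneg fun _ _ => hW _ _).1 h x (Finset.mem_univ x)

lemma powerMarginal_eq_zero (hW : ∀ s s', 0 ≤ W s s') {θ : ℝ} (hθ : -1 < θ) {y y' : Y}
    (h : marginal W y y' = 0) : powerMarginal W θ y y' = 0 := by
  rw [powerMarginal_eq hW hθ]
  exact Finset.sum_eq_zero fun x _ => by rw [eq_zero_of_marginal_eq_zero hW h, zero_mul]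

lemma rpow_convex_combination {w θ₁ θ₂ a b : ℝ} (hw : 0 ≤ w) (h₁ : -1 < θ₁) (h₂ : -1 < θ₂)
    (ha : 0 < a) (hb : 0 < b) (hab : a + b = 1) :
    (w ^ (1 + θ₁)) ^ a * (w ^ (1 + θ₂)) ^ b = w ^ (1 + (a * θ₁ + b * θ₂)) := by
  have e : (1 + θ₁) * a + (1 + θ₂) * b = 1 + (a * θ₁ + b * θ₂) := by linear_combination hab
  rw [← Real.rpow_mul hw, ← Real.rpow_mul hw, ← Real.rpow_add' hw, e]
  rw [e]
  nlinarith

lemma powerMarginal_convex (hW : ∀ s s', 0 ≤ W s s') {θ₁ θ₂ a b : ℝ}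
    (h₁ : -1 < θ₁) (h₂ : -1 < θ₂) (ha : 0 < a) (hb : 0 < b) (hab : a + b = 1) (y y' : Y) :
    powerMarginal W (a * θ₁ + b * θ₂) y y' ≤
      powerMarginal W θ₁ y y' ^ a * powerMarginal W θ₂ y y' ^ b := by
  rcases eq_or_lt_of_le (marginal_nonneg hW y y') with h | h
  · rw [powerMarginal_eq_zero hW (by nlinarith) h.symm]
    exact mul_nonneg (Real.rpow_nonneg (powerMarginal_nonneg hW _ _ _) _)
      (Real.rpow_nonneg (powerMarginal_nonneg hW _ _ _) _)
  · have := sum_rpow_mul_rpow_le ha hb hab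
      (fun x => Real.rpow_nonneg (hW (x, y) (Classical.arbitrary X, y')) (1 + θ₁))
      (fun x => Real.rpow_nonneg (hW (x, y) (Classical.arbitrary X, y')) (1 + θ₂))
      (powerMarginal_pos hW θ₁ h) (powerMarginal_pos hW θ₂ h)
    simp only [rpow_convex_combination (hW _ _) h₁ h₂ ha hb hab] at this
    exact this

/-- The information increment depends on the states only through `Y`, by the potential `ℓ`. -/
def HasPotential (W : Matrix (X × Y) (X × Y) ℝ) (ℓ : Y → Y → ℝ) : Prop :=
  ∀ s t, 0 < W s t → increment W s t = ℓ s.2 t.2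

/-- The information increment is a constant plus a coboundary on `Y`. -/
def IsMarginalCoboundary (W : Matrix (X × Y) (X × Y) ℝ) : Prop :=
  ∃ (c : ℝ) (g : Y → ℝ), HasPotential W fun y y' => c + g y - g y'

lemma IsMarginalCoboundary.isCoboundary (h : IsMarginalCoboundary W) : IsCoboundary W := by
  obtain ⟨c, g, hg⟩ := h
  exact ⟨c, fun s => g s.2, hg⟩

/-- Equality in Hölder fixes `W ^ (θ₁ - θ₂)` on the support within a column. Strong non-hiddenness
gives the column sums the same values for every `x'`, so equality holds in each column and the
common value depends on `y, y'` only. -/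
lemma exists_hasPotential (hW : ∀ s s', 0 ≤ W s s') (snh : StronglyNonHidden W)
    {θ₁ θ₂ a b : ℝ} (h₁ : -1 < θ₁) (h₂ : -1 < θ₂) (hne : θ₁ ≠ θ₂) (ha : 0 < a) (hb : 0 < b)
    (hab : a + b = 1)
    (h : ∀ y y', 0 < marginal W y y' → powerMarginal W (a * θ₁ + b * θ₂) y y' =
      powerMarginal W θ₁ y y' ^ a * powerMarginal W θ₂ y y' ^ b) :
    ∃ ℓ, HasPotential W ℓ := by
  refine ⟨fun y y' => (Real.log (powerMarginal W θ₁ y y') - Real.log (powerMarginal W θ₂ y y')) /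
    (θ₁ - θ₂) - Real.log (marginal W y y'), ?_⟩
  rintro ⟨x, y⟩ ⟨x', y'⟩ hs
  have hM : 0 < marginal W y y' := marginal_pos hW snh.nonHidden hs
  have p₁ := powerMarginal_pos hW θ₁ hM
  have p₂ := powerMarginal_pos hW θ₂ hM
  have e₁ := sum_eq_powerMarginal snh h₁ x' y y'
  have e₂ := sum_eq_powerMarginal snh h₂ x' y y'
  have e₃ := sum_eq_powerMarginal snh (show -1 < a * θ₁ + b * θ₂ by nlinarith) x' y y'
  have h3 := mul_sum_eq_of_sum_rpow_mul_rpow_eq ha hb hab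
    (fun x => Real.rpow_nonneg (hW (x, y) (x', y')) (1 + θ₁))
    (fun x => Real.rpow_nonneg (hW (x, y) (x', y')) (1 + θ₂)) (by rwa [e₁]) (by rwa [e₂])
    (by simp only [rpow_convex_combination (hW _ _) h₁ h₂ ha hb hab]
        rw [e₁, e₂, e₃, h y y' hM]) x
  rw [e₁, e₂] at h3
  have h4 := congrArg Real.log h3
  rw [Real.log_mul (Real.rpow_pos_of_pos hs _).ne' p₂.ne',
    Real.log_mul (Real.rpow_pos_of_pos hs _).ne' p₁.ne', Real.log_rpow hs, Real.log_rpow hs] at h4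
  have hsub : θ₁ - θ₂ ≠ 0 := sub_ne_zero.2 hne
  simp only [increment]
  rw [sub_left_inj, eq_div_iff hsub]
  linarith

/-- With a potential, `W` equals the marginal times `exp ℓ` on its support, so the power sum
factors. -/
lemma log_powerMarginal (hW : ∀ s s', 0 ≤ W s s') {ℓ : Y → Y → ℝ}
    (hℓ : HasPotential W ℓ) {θ : ℝ} (hθ : -1 < θ) {y y' : Y} (h : 0 < marginal W y y') :
    Real.log (powerMarginal W θ y y') = (1 + θ) * Real.log (marginal W y y') + θ * ℓ y y' := by
  have e : powerMarginal W θ y y' =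
      marginal W y y' * Real.exp (θ * (Real.log (marginal W y y') + ℓ y y')) := by
    rw [powerMarginal_eq hW hθ]
    simp only [marginal, of_apply]
    rw [Finset.sum_mul]
    refine Finset.sum_congr rfl fun x _ => ?_
    rcases eq_or_lt_of_le (hW (x, y) (Classical.arbitrary X, y')) with h0 | h0
    · rw [← h0, zero_mul, zero_mul]
    · have := hℓ _ _ h0
      simp only [increment, marginal, of_apply] at this
      congr 3
      linarith
  rw [e, Real.log_mul h.ne' (Real.exp_pos _).ne', Real.log_exp]
  ring

lemma kMatrix_eq_zero (hW : ∀ s s', 0 ≤ W s s') {θ : ℝ} (hθ : -1 < θ) {y y' : Y}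
    (h : marginal W y y' = 0) : kMatrix W θ y y' = 0 := by
  simp only [kMatrix, of_apply]
  rw [powerMarginal_eq_zero hW hθ h, Real.zero_rpow]
  exact (one_div_pos.2 (by linarith)).ne'

lemma kMatrix_eq_exp (hW : ∀ s s', 0 ≤ W s s') (θ : ℝ) {y y' : Y}
    (h : 0 < marginal W y y') :
    kMatrix W θ y y' = Real.exp (Real.log (powerMarginal W θ y y') / (1 + θ)) := by
  simp only [kMatrix, of_apply]
  rw [Real.rpow_def_of_pos (powerMarginal_pos hW θ h), mul_one_div]

lemma nMatrix_eq_zero (hW : ∀ s s', 0 ≤ W s s') {θ : ℝ} (hθ : -1 < θ) (θ' : ℝ) {y y' : Y}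
    (h : marginal W y y' = 0) : nMatrix W θ θ' y y' = 0 := by
  simp only [nMatrix, of_apply]
  rw [powerMarginal_eq_zero hW hθ h, zero_mul]

lemma nMatrix_eq_exp (hW : ∀ s s', 0 ≤ W s s') (θ θ' : ℝ) {y y' : Y}
    (h : 0 < marginal W y y') :
    nMatrix W θ θ' y y' = powerMarginal W θ y y' *
      Real.exp (-θ / (1 + θ') * Real.log (powerMarginal W θ' y y')) := by
  simp only [nMatrix, of_apply]
  rw [Real.rpow_def_of_pos (powerMarginal_pos hW θ' h), mul_comm (Real.log _)]

lemma nMatrix_eq_exp_log (hW : ∀ s s', 0 ≤ W s s') (θ θ' : ℝ) {y y' : Y}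
    (h : 0 < marginal W y y') :
    nMatrix W θ θ' y y' = Real.exp (Real.log (powerMarginal W θ y y')
      - θ / (1 + θ') * Real.log (powerMarginal W θ' y y')) := by
  rw [nMatrix_eq_exp hW θ θ' h, sub_eq_add_neg, Real.exp_add,
    Real.exp_log (powerMarginal_pos hW θ h)]
  congr 2
  ring

lemma kMatrix_isIrreducible (hirr : W.IsIrreducible) (snh : StronglyNonHidden W) (θ : ℝ) :
    (kMatrix W θ).IsIrreducible :=
  isIrreducible_of_pos (marginal_isIrreducible hirr snh.nonHidden)
    (fun _ _ => Real.rpow_nonneg (powerMarginal_nonneg hirr.nonneg _ _ _) _)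
    fun y y' h => by rw [kMatrix_eq_exp hirr.nonneg θ h]; exact Real.exp_pos _

lemma nMatrix_isIrreducible (hirr : W.IsIrreducible) (snh : StronglyNonHidden W) (θ θ' : ℝ) :
    (nMatrix W θ θ').IsIrreducible :=
  isIrreducible_of_pos (marginal_isIrreducible hirr snh.nonHidden)
    (fun _ _ => mul_nonneg (powerMarginal_nonneg hirr.nonneg _ _ _)
      (Real.rpow_nonneg (powerMarginal_nonneg hirr.nonneg _ _ _) _))
    fun y y' h => by rw [nMatrix_eq_exp_log hirr.nonneg θ θ' h]; exact Real.exp_pos _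

lemma kMatrix_zero : kMatrix W 0 = marginal W := by
  ext y y'
  simp [kMatrix, powerMarginal_zero]

lemma nMatrix_zero (θ' : ℝ) : nMatrix W 0 θ' = marginal W := by
  ext y y'
  simp [nMatrix, powerMarginal_zero]

lemma nMatrix_self (hW : ∀ s s', 0 ≤ W s s') {θ : ℝ} (hθ : -1 < θ) :
    nMatrix W θ θ = kMatrix W θ := by
  ext y y'
  have h1 : 1 + θ ≠ 0 := by linarith
  rcases eq_or_lt_of_le (marginal_nonneg hW y y') with h | h
  · rw [nMatrix_eq_zero hW hθ θ h.symm, kMatrix_eq_zero hW hθ h.symm]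
  · rw [nMatrix_eq_exp_log hW θ θ h, kMatrix_eq_exp hW θ h]
    congr 1
    field_simp
    ring

/-- Since `K_θ ^ (1 + θ) = W_θ`, Hölder for `W_θ` becomes a geometric mean with reweighted
exponents, which again sum to `1`. This is why `(1 + θ) * log ρ`, and not `log ρ`, comes out convex.
-/
lemma kMatrix_convex (hW : ∀ s s', 0 ≤ W s s') {θ₁ θ₂ a b θ : ℝ} (h₁ : -1 < θ₁) (h₂ : -1 < θ₂)
    (ha : 0 < a) (hb : 0 < b) (hab : a + b = 1) (hθ : θ = a * θ₁ + b * θ₂) (y y' : Y) :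
    kMatrix W θ y y' ≤ kMatrix W θ₁ y y' ^ (a * (1 + θ₁) / (1 + θ)) *
      kMatrix W θ₂ y y' ^ (b * (1 + θ₂) / (1 + θ)) := by
  have h0 : -1 < θ := by nlinarith
  rcases eq_or_lt_of_le (marginal_nonneg hW y y') with h | h
  · rw [kMatrix_eq_zero hW h0 h.symm]
    exact mul_nonneg (Real.rpow_nonneg (Real.rpow_nonneg (powerMarginal_nonneg hW _ _ _) _) _)
      (Real.rpow_nonneg (Real.rpow_nonneg (powerMarginal_nonneg hW _ _ _) _) _)
  · have e := Real.log_le_log (powerMarginal_pos hW _ h) (powerMarginal_convex hW h₁ h₂ ha hb hab y y')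
    have p₁ := powerMarginal_pos hW θ₁ h
    have p₂ := powerMarginal_pos hW θ₂ h
    rw [Real.log_mul (by positivity) (by positivity), Real.log_rpow p₁, Real.log_rpow p₂, ← hθ] at e
    rw [kMatrix_eq_exp hW _ h, kMatrix_eq_exp hW _ h, kMatrix_eq_exp hW _ h, ← Real.exp_mul,
      ← Real.exp_mul, ← Real.exp_add, Real.exp_le_exp]
    have i₀ : 0 < 1 + θ := by linarith
    have i₁ : 0 < 1 + θ₁ := by linarith
    have i₂ : 0 < 1 + θ₂ := by linarith
    rw [div_le_iff₀ i₀]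
    refine e.trans_eq ?_
    field_simp

/-- The second factor of `nMatrix` is exactly log-linear in `θ`, so only Hölder for the first factor
enters. -/
lemma nMatrix_convex (hW : ∀ s s', 0 ≤ W s s') {θ₁ θ₂ a b : ℝ} (θ' : ℝ) (h₁ : -1 < θ₁)
    (h₂ : -1 < θ₂) (ha : 0 < a) (hb : 0 < b) (hab : a + b = 1) (y y' : Y) :
    nMatrix W (a * θ₁ + b * θ₂) θ' y y' ≤ nMatrix W θ₁ θ' y y' ^ a * nMatrix W θ₂ θ' y y' ^ b := by
  rcases eq_or_lt_of_le (marginal_nonneg hW y y') with h | h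
  · rw [nMatrix_eq_zero hW (by nlinarith) θ' h.symm, nMatrix_eq_zero hW h₁ θ' h.symm,
      Real.zero_rpow ha.ne', zero_mul]
  · have e := Real.log_le_log (powerMarginal_pos hW _ h) (powerMarginal_convex hW h₁ h₂ ha hb hab y y')
    have p₁ := powerMarginal_pos hW θ₁ h
    have p₂ := powerMarginal_pos hW θ₂ h
    rw [Real.log_mul (by positivity) (by positivity), Real.log_rpow p₁, Real.log_rpow p₂] at e
    rw [nMatrix_eq_exp_log hW _ _ h, nMatrix_eq_exp_log hW _ _ h, nMatrix_eq_exp_log hW _ _ h,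
      ← Real.exp_mul, ← Real.exp_mul, ← Real.exp_add, Real.exp_le_exp]
    have e2 : (a * θ₁ + b * θ₂) / (1 + θ') = a * (θ₁ / (1 + θ')) + b * (θ₂ / (1 + θ')) := by ring
    rw [e2]
    linarith

lemma kMatrix_of_hasPotential (hW : ∀ s s', 0 ≤ W s s') {ℓ : Y → Y → ℝ}
    (hℓ : HasPotential W ℓ) {θ : ℝ} (hθ : -1 < θ) (y y' : Y) :
    kMatrix W θ y y' = marginal W y y' * Real.exp (θ / (1 + θ) * ℓ y y') := by
  rcases eq_or_lt_of_le (marginal_nonneg hW y y') with h | h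
  · rw [kMatrix_eq_zero hW hθ h.symm, ← h, zero_mul]
  · have h1 : 1 + θ ≠ 0 := by linarith
    conv_rhs => rw [← Real.exp_log h]
    rw [kMatrix_eq_exp hW _ h, log_powerMarginal hW hℓ hθ h, ← Real.exp_add]
    congr 1
    field_simp

lemma nMatrix_of_hasPotential (hW : ∀ s s', 0 ≤ W s s') {ℓ : Y → Y → ℝ}
    (hℓ : HasPotential W ℓ) {θ θ' : ℝ} (hθ : -1 < θ) (hθ' : -1 < θ') (y y' : Y) :
    nMatrix W θ θ' y y' = marginal W y y' * Real.exp (θ / (1 + θ') * ℓ y y') := by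
  rcases eq_or_lt_of_le (marginal_nonneg hW y y') with h | h
  · rw [nMatrix_eq_zero hW hθ θ' h.symm, ← h, zero_mul]
  · have h1 : 1 + θ' ≠ 0 := by linarith
    conv_rhs => rw [← Real.exp_log h]
    rw [nMatrix_eq_exp_log hW _ _ h, log_powerMarginal hW hℓ hθ h, log_powerMarginal hW hℓ hθ' h,
      ← Real.exp_add]
    congr 1
    field_simp
    ring

/-- Two tilts of the marginal by different multiples of `ℓ` that are gauge equivalent differ by a
tilt by `(κ₁ - κ₂) * ℓ`; dividing by `κ₁ - κ₂` solves for `ℓ`. -/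
lemma isMarginalCoboundary_of_gauge (hW : ∀ s s', 0 ≤ W s s') (nh : NonHidden W)
    {ℓ : Y → Y → ℝ} (hℓ : HasPotential W ℓ) {κ₁ κ₂ c : ℝ} (hκ : κ₁ ≠ κ₂) {g : Y → ℝ}
    (h : ∀ y y', marginal W y y' * Real.exp (κ₁ * ℓ y y') =
      Real.exp (c + g y - g y') * (marginal W y y' * Real.exp (κ₂ * ℓ y y'))) :
    IsMarginalCoboundary W := by
  have hsub : κ₁ - κ₂ ≠ 0 := sub_ne_zero.2 hκ
  refine ⟨c / (κ₁ - κ₂), fun y => g y / (κ₁ - κ₂), fun s s' hs => ?_⟩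
  have h3 := h s.2 s'.2
  rw [mul_left_comm, ← Real.exp_add] at h3
  have h4 := Real.exp_injective (mul_left_cancel₀ (marginal_pos hW nh hs).ne' h3)
  rw [hℓ s s' hs]
  field_simp
  linarith

variable [Nonempty Y]

lemma pfEigenvalue_marginal (hW : W ∈ Matrix.colStochastic ℝ (X × Y)) (hirr : W.IsIrreducible)
    (nh : NonHidden W) : pfEigenvalue (marginal W) = 1 :=
  pfEigenvalue_eq_one_of_colStochastic (marginal_mem_colStochastic hW)
    (marginal_isIrreducible hirr nh)

lemma log_pfEigenvalue_of_gauge (hW : W ∈ Matrix.colStochastic ℝ (X × Y))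
    (hirr : W.IsIrreducible) (nh : NonHidden W) {A : Matrix Y Y ℝ} (hA : A.IsIrreducible)
    {c κ : ℝ} {g : Y → ℝ}
    (h : ∀ y y', A y y' = marginal W y y' * Real.exp (κ * (c + g y - g y'))) :
    Real.log (pfEigenvalue A) = κ * c := by
  rw [pfEigenvalue_gauge hA (marginal_isIrreducible hirr nh) (κ * c) (fun y => κ * g y)
    fun y y' => ?_, pfEigenvalue_marginal hW hirr nh, mul_one, Real.log_exp]
  rw [h, mul_comm]
  congr 2
  ring

/-- Lumping: the tilted matrix has the same Perron-Frobenius eigenvalue as its `Y`-marginal. -/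
lemma pfEigenvalue_tilted_eq (hirr : W.IsIrreducible) (snh : StronglyNonHidden W) {θ : ℝ}
    (hθ : -1 < θ) : pfEigenvalue (tilted W θ) = pfEigenvalue (nMatrix W θ 0) := by
  obtain ⟨u, -, hu, -, hNu, -, -⟩ := exists_perron_vectors (nMatrix_isIrreducible hirr snh θ 0)
  -- A left Perron vector on `Y`, pulled back to `X × Y`, stays a left eigenvector because the sum
  -- over `x` does not depend on `x'`.
  refine pfEigenvalue_eq_of_vecMul (tilted_isIrreducible hirr snh.nonHidden hθ)
    (u := fun s => u s.2) (fun s => hu s.2) ?_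
  ext ⟨x', y'⟩
  have h1 := congrFun hNu y'
  simp only [vecMul, dotProduct, Pi.smul_apply, smul_eq_mul] at h1 ⊢
  rw [← h1, Fintype.sum_prod_type_right]
  refine Finset.sum_congr rfl fun y _ => ?_
  simp only
  rw [← Finset.mul_sum]
  congr 1
  simp only [tilted, nMatrix, of_apply, powerMarginal_zero]
  rw [← Finset.sum_mul, sum_eq_powerMarginal snh hθ]
  norm_num

lemma convexOn_log_nMatrix (hirr : W.IsIrreducible) (snh : StronglyNonHidden W) (θ' : ℝ) :
    ConvexOn ℝ (Ioi (-1)) fun θ => Real.log (pfEigenvalue (nMatrix W θ θ')) := by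
  refine convexOn_iff_forall_pos.2 ⟨convex_Ioi _, fun θ₁ h₁ θ₂ h₂ a b ha hb hab => ?_⟩
  simp only [smul_eq_mul]
  exact log_pfEigenvalue_le (nMatrix_isIrreducible hirr snh _ _)
    (nMatrix_isIrreducible hirr snh _ _) (nMatrix_isIrreducible hirr snh _ _) ha hb hab
    (nMatrix_convex hirr.nonneg θ' h₁ h₂ ha hb hab)

/-- Entrywise equality, the first conclusion of the equality case, is equality in Hölder over `x`
and yields a potential; the gauge, the second conclusion, then turns the potential into a
coboundary. -/
lemma isMarginalCoboundary_of_nMatrix (hirr : W.IsIrreducible) (snh : StronglyNonHidden W)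
    {θ₁ θ₂ a b θ' : ℝ} (h₁ : -1 < θ₁) (h₂ : -1 < θ₂) (hne : θ₁ ≠ θ₂) (ha : 0 < a) (hb : 0 < b)
    (hab : a + b = 1) (hθ' : -1 < θ')
    (heq : Real.log (pfEigenvalue (nMatrix W (a * θ₁ + b * θ₂) θ')) =
      a * Real.log (pfEigenvalue (nMatrix W θ₁ θ')) +
        b * Real.log (pfEigenvalue (nMatrix W θ₂ θ'))) : IsMarginalCoboundary W := by
  have hW := hirr.nonneg
  obtain ⟨h3, c, g, hg⟩ := gauge_of_log_pfEigenvalue_eq (nMatrix_isIrreducible hirr snh _ _)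
    (nMatrix_isIrreducible hirr snh _ _) (nMatrix_isIrreducible hirr snh _ _) ha hb hab
    (nMatrix_convex hirr.nonneg θ' h₁ h₂ ha hb hab) heq
  obtain ⟨ℓ, hℓ⟩ := exists_hasPotential hW snh h₁ h₂ hne ha hb hab fun y y' h => by
    have h4 := h3 y y'
    have p₁ := powerMarginal_pos hW θ₁ h
    have p₂ := powerMarginal_pos hW θ₂ h
    rw [nMatrix_eq_exp_log hW _ _ h, nMatrix_eq_exp_log hW _ _ h, nMatrix_eq_exp_log hW _ _ h,
      ← Real.exp_mul, ← Real.exp_mul, ← Real.exp_add] at h4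
    have h5 := Real.exp_injective h4
    refine Real.log_injOn_pos (powerMarginal_pos hW _ h) (mem_Ioi.2 (by positivity)) ?_
    rw [Real.log_mul (by positivity) (by positivity), Real.log_rpow p₁, Real.log_rpow p₂]
    have e2 : (a * θ₁ + b * θ₂) / (1 + θ') = a * (θ₁ / (1 + θ')) + b * (θ₂ / (1 + θ')) := by ring
    rw [e2] at h5
    linarith
  have h0 : 1 + θ' ≠ 0 := by linarith
  refine isMarginalCoboundary_of_gauge hW snh.nonHidden hℓ (κ₁ := θ₁ / (1 + θ'))
    (κ₂ := θ₂ / (1 + θ')) (fun h => hne ?_) (c := c) (g := g) fun y y' => ?_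
  · field_simp at h
    exact h
  · rw [← nMatrix_of_hasPotential hW hℓ h₁ hθ', ← nMatrix_of_hasPotential hW hℓ h₂ hθ', hg]

lemma strictConvexOn_log_nMatrix (hirr : W.IsIrreducible) (snh : StronglyNonHidden W) {θ' : ℝ}
    (hθ' : -1 < θ') (hc : ¬IsMarginalCoboundary W) :
    StrictConvexOn ℝ (Ioi (-1)) fun θ => Real.log (pfEigenvalue (nMatrix W θ θ')) := by
  refine ⟨convex_Ioi _, fun θ₁ h₁ θ₂ h₂ hne a b ha hb hab => ?_⟩
  refine lt_of_le_of_ne ((convexOn_log_nMatrix hirr snh θ').2 h₁ h₂ ha.le hb.le hab)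
    fun heq => hc ?_
  exact isMarginalCoboundary_of_nMatrix hirr snh h₁ h₂ hne ha hb hab hθ' heq

lemma convexOn_log_kMatrix (hirr : W.IsIrreducible) (snh : StronglyNonHidden W) :
    ConvexOn ℝ (Ioi (-1)) fun θ => (1 + θ) * Real.log (pfEigenvalue (kMatrix W θ)) := by
  refine convexOn_iff_forall_pos.2 ⟨convex_Ioi _, fun θ₁ h₁ θ₂ h₂ a b ha hb hab => ?_⟩
  have h₁ : 0 < 1 + θ₁ := by linarith [mem_Ioi.1 h₁]
  have h₂ : 0 < 1 + θ₂ := by linarith [mem_Ioi.1 h₂]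
  simp only [smul_eq_mul]
  have h0 : 0 < 1 + (a * θ₁ + b * θ₂) := by nlinarith
  have := log_pfEigenvalue_le (kMatrix_isIrreducible hirr snh _)
    (kMatrix_isIrreducible hirr snh _) (kMatrix_isIrreducible hirr snh _)
    (div_pos (mul_pos ha h₁) h0) (div_pos (mul_pos hb h₂) h0)
    (by field_simp; linear_combination hab)
    (kMatrix_convex hirr.nonneg (by linarith) (by linarith) ha hb hab rfl)
  have := mul_le_mul_of_nonneg_left this h0.le
  refine this.trans_eq ?_
  field_simp

lemma strictConvexOn_log_kMatrix (hirr : W.IsIrreducible) (snh : StronglyNonHidden W)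
    (hc : ¬IsMarginalCoboundary W) :
    StrictConvexOn ℝ (Ioi (-1)) fun θ => (1 + θ) * Real.log (pfEigenvalue (kMatrix W θ)) := by
  refine ⟨convex_Ioi _, fun θ₁ h₁ θ₂ h₂ hne a b ha hb hab => ?_⟩
  refine lt_of_le_of_ne ((convexOn_log_kMatrix hirr snh).2 h₁ h₂ ha.le hb.le hab)
    fun heq => hc ?_
  have hW := hirr.nonneg
  have h₁ : -1 < θ₁ := h₁
  have h₂ : -1 < θ₂ := h₂
  have i₁ : 0 < 1 + θ₁ := by linarith
  have i₂ : 0 < 1 + θ₂ := by linarith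
  simp only [smul_eq_mul] at heq
  have h0 : 0 < 1 + (a * θ₁ + b * θ₂) := by nlinarith
  obtain ⟨h3, c, g, hg⟩ := gauge_of_log_pfEigenvalue_eq (kMatrix_isIrreducible hirr snh _)
    (kMatrix_isIrreducible hirr snh _) (kMatrix_isIrreducible hirr snh _)
    (div_pos (mul_pos ha i₁) h0) (div_pos (mul_pos hb i₂) h0)
    (by field_simp; linear_combination hab)
    (kMatrix_convex hirr.nonneg h₁ h₂ ha hb hab rfl)
    (by field_simp; linarith)
  obtain ⟨ℓ, hℓ⟩ := exists_hasPotential hW snh h₁ h₂ hne ha hb hab fun y y' h => by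
    have h4 := h3 y y'
    have p₁ := powerMarginal_pos hW θ₁ h
    have p₂ := powerMarginal_pos hW θ₂ h
    rw [kMatrix_eq_exp hW _ h, kMatrix_eq_exp hW _ h, kMatrix_eq_exp hW _ h, ← Real.exp_mul,
      ← Real.exp_mul, ← Real.exp_add] at h4
    have h5 := Real.exp_injective h4
    refine Real.log_injOn_pos (powerMarginal_pos hW _ h) (mem_Ioi.2 (by positivity)) ?_
    rw [Real.log_mul (by positivity) (by positivity), Real.log_rpow p₁, Real.log_rpow p₂]
    field_simp at h5
    linarith
  refine isMarginalCoboundary_of_gauge hW snh.nonHidden hℓ (κ₁ := θ₁ / (1 + θ₁))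
    (κ₂ := θ₂ / (1 + θ₂)) (fun h => hne ?_) (c := c) (g := g) fun y y' => ?_
  · field_simp at h
    linarith
  · rw [← kMatrix_of_hasPotential hW hℓ h₁, ← kMatrix_of_hasPotential hW hℓ h₂, hg]

/-- For strongly non-hidden matrices, a coboundary on `X × Y` descends to `Y`. -/
lemma IsCoboundary.isMarginalCoboundary (hW : W ∈ Matrix.colStochastic ℝ (X × Y))
    (hirr : W.IsIrreducible) (snh : StronglyNonHidden W) (hc : IsCoboundary W) :
    IsMarginalCoboundary W := by
  obtain ⟨c, hc⟩ := log_tilted_eq_of_isCoboundary hW hirr snh.nonHidden hc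
  -- Linearity of `log ρ` gives equality in the convexity inequality for any pair of parameters; `1`
  -- and `3` are one choice, and `θ' = 0` is where lumping applies.
  refine isMarginalCoboundary_of_nMatrix hirr snh (θ₁ := 1) (θ₂ := 3) (a := 1 / 2) (b := 1 / 2)
    (θ' := 0) (by norm_num) (by norm_num) (by norm_num) (by norm_num) (by norm_num) (by norm_num)
    (by norm_num) ?_
  rw [← pfEigenvalue_tilted_eq hirr snh (by norm_num), ← pfEigenvalue_tilted_eq hirr snh
    (by norm_num), ← pfEigenvalue_tilted_eq hirr snh (by norm_num), hc _ (by norm_num),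
    hc _ (by norm_num), hc _ (by norm_num)]
  ring

end Upper

end MarkovRenyi

/-! ### Differentiability, limits and comparison of the upper and two-parameter entropies -/

namespace MarkovRenyi

section Upper

open Matrix

variable {X Y : Type*} [Fintype X] [DecidableEq X] [Fintype Y] [DecidableEq Y] [Nonempty X]
  {W : Matrix (X × Y) (X × Y) ℝ}

/-- The derivative of `powerMarginal W θ` in `θ`. -/
noncomputable def powerMarginalDeriv (W : Matrix (X × Y) (X × Y) ℝ) (θ : ℝ) (y y' : Y) : ℝ :=
  ∑ x, W (x, y) (Classical.arbitrary X, y') *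
    (Real.exp (θ * Real.log (W (x, y) (Classical.arbitrary X, y'))) *
      Real.log (W (x, y) (Classical.arbitrary X, y')))

lemma hasDerivAt_powerMarginal (hW : ∀ s s', 0 ≤ W s s') {θ : ℝ} (hθ : -1 < θ) (y y' : Y) :
    HasDerivAt (fun t => powerMarginal W t y y') (powerMarginalDeriv W θ y y') θ := by
  have h1 : HasDerivAt (fun t => ∑ x, W (x, y) (Classical.arbitrary X, y') *
      Real.exp (t * Real.log (W (x, y) (Classical.arbitrary X, y'))))
      (powerMarginalDeriv W θ y y') θ :=
    HasDerivAt.fun_sum fun x _ => ((hasDerivAt_mul_const _).exp).const_mul _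
  refine h1.congr_of_eventuallyEq ?_
  filter_upwards [isOpen_Ioi.mem_nhds (mem_Ioi.2 hθ)] with t ht
  exact powerMarginal_eq hW ht y y'

lemma differentiableAt_log_powerMarginal (hW : ∀ s s', 0 ≤ W s s') {θ : ℝ} (hθ : -1 < θ)
    {y y' : Y} (h : 0 < marginal W y y') :
    DifferentiableAt ℝ (fun t => Real.log (powerMarginal W t y y')) θ :=
  (hasDerivAt_powerMarginal hW hθ y y').differentiableAt.log (powerMarginal_pos hW θ h).ne'

lemma differentiableAt_kMatrix (hW : ∀ s s', 0 ≤ W s s') {θ : ℝ} (hθ : -1 < θ) (y y' : Y) :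
    DifferentiableAt ℝ (fun t => kMatrix W t y y') θ := by
  rcases eq_or_lt_of_le (marginal_nonneg hW y y') with h | h
  · refine (differentiableAt_const (0 : ℝ)).congr_of_eventuallyEq ?_
    filter_upwards [isOpen_Ioi.mem_nhds (mem_Ioi.2 hθ)] with t ht
    exact kMatrix_eq_zero hW ht h.symm
  · simp only [kMatrix_eq_exp hW _ h]
    exact ((differentiableAt_log_powerMarginal hW hθ h).fun_div (by fun_prop)
      (by linarith : 1 + θ ≠ 0)).exp

lemma differentiableAt_nMatrix_left (hW : ∀ s s', 0 ≤ W s s') {θ : ℝ} (hθ : -1 < θ) (θ' : ℝ)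
    (y y' : Y) : DifferentiableAt ℝ (fun t => nMatrix W t θ' y y') θ := by
  rcases eq_or_lt_of_le (marginal_nonneg hW y y') with h | h
  · refine (differentiableAt_const (0 : ℝ)).congr_of_eventuallyEq ?_
    filter_upwards [isOpen_Ioi.mem_nhds (mem_Ioi.2 hθ)] with t ht
    exact nMatrix_eq_zero hW ht θ' h.symm
  · simp only [nMatrix_eq_exp_log hW _ _ h]
    exact ((differentiableAt_log_powerMarginal hW hθ h).fun_sub (by fun_prop)).exp

lemma differentiableAt_nMatrix_right (hW : ∀ s s', 0 ≤ W s s') {θ θ' : ℝ} (hθ : -1 < θ)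
    (hθ' : -1 < θ') (y y' : Y) : DifferentiableAt ℝ (fun t => nMatrix W θ t y y') θ' := by
  rcases eq_or_lt_of_le (marginal_nonneg hW y y') with h | h
  · simp only [nMatrix_eq_zero hW hθ _ h.symm]
    exact differentiableAt_const _
  · simp only [nMatrix_eq_exp_log hW _ _ h]
    refine DifferentiableAt.exp (DifferentiableAt.fun_sub (by fun_prop) (DifferentiableAt.fun_mul ?_
      (differentiableAt_log_powerMarginal hW hθ' h)))
    exact DifferentiableAt.fun_div (by fun_prop) (by fun_prop) (by linarith : 1 + θ' ≠ 0)

lemma differentiableAt_log_pfEigenvalue {n : Type*} [Fintype n] [DecidableEq n] [Nonempty n]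
    {A : ℝ → Matrix n n ℝ} {t₀ : ℝ} (hA : ∀ t, (A t).IsIrreducible)
    (hd : ∀ i j, DifferentiableAt ℝ (fun t => A t i j) t₀) :
    DifferentiableAt ℝ (fun t => Real.log (pfEigenvalue (A t))) t₀ := by
  obtain ⟨L, hL⟩ := exists_hasDerivAt_pfEigenvalue (hA t₀)
  exact (hL A (Matrix.of fun i j => deriv (fun t => A t i j) t₀) t₀ rfl (Eventually.of_forall hA)
    fun i j => (hd i j).hasDerivAt).differentiableAt.log (pfEigenvalue_pos (hA t₀)).ne'

variable [Nonempty Y]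

/-- At `0` the logarithms of the Perron-Frobenius eigenvalues of `nMatrix W θ 0` and `kMatrix W θ`
agree to first order. -/
lemma exists_hasDerivAt_nMatrix_kMatrix (hW : W ∈ Matrix.colStochastic ℝ (X × Y))
    (hirr : W.IsIrreducible) (snh : StronglyNonHidden W) :
    ∃ d, HasDerivAt (fun t => Real.log (pfEigenvalue (nMatrix W t 0))) d 0 ∧
      HasDerivAt (fun t => (1 + t) * Real.log (pfEigenvalue (kMatrix W t))) d 0 := by
  have hW0 := hirr.nonneg
  have hM := pfEigenvalue_marginal hW hirr snh.nonHidden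
  obtain ⟨L, hL⟩ := exists_hasDerivAt_pfEigenvalue (marginal_isIrreducible hirr snh.nonHidden)
  -- Both families pass through the marginal at `0` with this same entrywise derivative, so a single
  -- functional `L` gives both derivatives of the eigenvalue.
  set A' : Matrix Y Y ℝ := Matrix.of fun y y' =>
    powerMarginalDeriv W 0 y y' - marginal W y y' * Real.log (marginal W y y') with hA'
  have hz : ∀ y y', marginal W y y' = 0 → A' y y' = 0 := fun y y' h => by
    simp only [hA', of_apply, h, powerMarginalDeriv, eq_zero_of_marginal_eq_zero hW0 h]
    simp
  have hp : ∀ y y', HasDerivAt (fun t => powerMarginal W t y y') (powerMarginalDeriv W 0 y y') 0 :=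
    fun y y' => hasDerivAt_powerMarginal hW0 (by norm_num) y y'
  have hk : ∀ y y', HasDerivAt (fun t => kMatrix W t y y') (A' y y') 0 := by
    intro y y'
    rcases eq_or_lt_of_le (marginal_nonneg hW0 y y') with h | h
    · rw [hz y y' h.symm]
      refine (hasDerivAt_const (0 : ℝ) (0 : ℝ)).congr_of_eventuallyEq ?_
      filter_upwards [eventually_gt_neg_one] with t ht
      exact kMatrix_eq_zero hW0 ht h.symm
    · simp only [kMatrix_eq_exp hW0 _ h]
      have h1 := (((hp y y').log (powerMarginal_pos hW0 0 h).ne').fun_div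
        ((hasDerivAt_id (0 : ℝ)).const_add 1) (by norm_num)).exp
      simp only [id, powerMarginal_zero, add_zero, div_one, Real.exp_log h] at h1
      refine h1.congr_deriv ?_
      simp only [hA', of_apply]
      field_simp
  have hn : ∀ y y', HasDerivAt (fun t => nMatrix W t 0 y y') (A' y y') 0 := by
    intro y y'
    rcases eq_or_lt_of_le (marginal_nonneg hW0 y y') with h | h
    · rw [hz y y' h.symm]
      refine (hasDerivAt_const (0 : ℝ) (0 : ℝ)).congr_of_eventuallyEq ?_
      filter_upwards [eventually_gt_neg_one] with t ht
      exact nMatrix_eq_zero hW0 ht 0 h.symm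
    · simp only [nMatrix_eq_exp hW0 _ _ h]
      have h1 := (hp y y').fun_mul
        ((((hasDerivAt_id (0 : ℝ)).fun_neg.div_const (1 + 0)).mul_const
          (Real.log (powerMarginal W 0 y y'))).exp)
      simp only [id, powerMarginal_zero] at h1
      rw [powerMarginal_zero]
      refine h1.congr_deriv ?_
      simp only [hA', of_apply]
      simp
      ring
  have dk := (hL (kMatrix W) A' 0 kMatrix_zero
    (Eventually.of_forall (kMatrix_isIrreducible hirr snh)) hk).log
    (by rw [kMatrix_zero, hM]; norm_num)
  have dn := (hL (fun t => nMatrix W t 0) A' 0 (nMatrix_zero 0)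
    (Eventually.of_forall fun t => nMatrix_isIrreducible hirr snh t 0) hn).log
    (by rw [nMatrix_zero, hM]; norm_num)
  rw [kMatrix_zero, hM, div_one] at dk
  rw [nMatrix_zero, hM, div_one] at dn
  refine ⟨L A', dn, ?_⟩
  -- The factor `1 + t` contributes nothing, since `log ρ` vanishes at `0`.
  have := ((hasDerivAt_id (0 : ℝ)).const_add 1).fun_mul dk
  simp only [id, kMatrix_zero, hM, Real.log_one, mul_zero, add_zero, zero_add, one_mul] at this
  exact this

lemma upperEntropy_of_ne {θ : ℝ} (h0 : θ ≠ 0) (h1 : θ ≠ -1) :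
    upperEntropy W θ = -((1 + θ) / θ) * Real.log (pfEigenvalue (kMatrix W θ)) := by
  simp [upperEntropy, h0, h1]

lemma log_pfEigenvalue_kMatrix_zero (hW : W ∈ Matrix.colStochastic ℝ (X × Y))
    (hirr : W.IsIrreducible) (snh : StronglyNonHidden W) :
    Real.log (pfEigenvalue (kMatrix W 0)) = 0 := by
  rw [kMatrix_zero, pfEigenvalue_marginal hW hirr snh.nonHidden, Real.log_one]

lemma log_pfEigenvalue_nMatrix_zero (hW : W ∈ Matrix.colStochastic ℝ (X × Y))
    (hirr : W.IsIrreducible) (snh : StronglyNonHidden W) (θ' : ℝ) :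
    Real.log (pfEigenvalue (nMatrix W 0 θ')) = 0 := by
  rw [nMatrix_zero, pfEigenvalue_marginal hW hirr snh.nonHidden, Real.log_one]

lemma mul_upperEntropy (hW : W ∈ Matrix.colStochastic ℝ (X × Y)) (hirr : W.IsIrreducible)
    (snh : StronglyNonHidden W) (θ : ℝ) (hθ : -1 < θ) :
    θ * upperEntropy W θ = -((1 + θ) * Real.log (pfEigenvalue (kMatrix W θ))) := by
  rcases eq_or_ne θ 0 with rfl | h0
  · rw [log_pfEigenvalue_kMatrix_zero hW hirr snh]
    simp
  · rw [upperEntropy_of_ne h0 hθ.ne']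
    field_simp

lemma tendsto_upperEntropy_zero (hW : W ∈ Matrix.colStochastic ℝ (X × Y))
    (hirr : W.IsIrreducible) (snh : StronglyNonHidden W) {d : ℝ}
    (hd : HasDerivAt (fun t => (1 + t) * Real.log (pfEigenvalue (kMatrix W t))) d 0) :
    upperEntropy W 0 = -d ∧ Tendsto (upperEntropy W) (𝓝[≠] 0) (𝓝 (-d)) := by
  have h1 := tendsto_neg_div_of_hasDerivAt
    (by rw [log_pfEigenvalue_kMatrix_zero hW hirr snh, mul_zero]) hd
  have h2 : Tendsto (fun t => -((1 + t) / t) * Real.log (pfEigenvalue (kMatrix W t))) (𝓝[≠] 0)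
      (𝓝 (-d)) := h1.congr fun t => by ring
  refine ⟨?_, h2.congr' ?_⟩
  · simp only [upperEntropy, if_true]
    exact h2.limUnder_eq
  · filter_upwards [self_mem_nhdsWithin, eventually_ne_neg_one] with t ht ht'
    rw [upperEntropy_of_ne ht ht']

/-- The entries of `kMatrix` are at most `|X| ^ (1 / (1 + θ))`, which may blow up at `-1`; the
prefactor `1 + θ` cancels exactly this exponent, leaving a uniform bound. -/
lemma log_kMatrix_le (hW : W ∈ Matrix.colStochastic ℝ (X × Y)) (hirr : W.IsIrreducible)
    (snh : StronglyNonHidden W) {θ : ℝ} (h₁ : -1 < θ) (h₂ : θ < 0) :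
    (1 + θ) * Real.log (pfEigenvalue (kMatrix W θ)) ≤
      Real.log (Fintype.card Y) + Real.log (Fintype.card X) := by
  have hX : (0 : ℝ) < Fintype.card X := by exact_mod_cast Fintype.card_pos
  have hY : (1 : ℝ) ≤ Fintype.card Y := by exact_mod_cast Fintype.card_pos
  have h0 : 0 < 1 + θ := by linarith
  have hp : ∀ y y', powerMarginal W θ y y' ≤ Fintype.card X := fun y y' => by
    refine (Finset.sum_le_sum fun x _ => Real.rpow_le_one (hirr.nonneg _ _)
      (Matrix.le_one_of_mem_colStochastic hW) h0.le).trans_eq ?_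
    simp
  have hk : ∀ y y', kMatrix W θ y y' ≤ (Fintype.card X : ℝ) ^ (1 / (1 + θ)) := fun y y' =>
    Real.rpow_le_rpow (powerMarginal_nonneg hirr.nonneg _ _ _) (hp y y') (by positivity)
  have h3 : pfEigenvalue (kMatrix W θ) ≤ Fintype.card Y * (Fintype.card X : ℝ) ^ (1 / (1 + θ)) := by
    refine pfEigenvalue_le (kMatrix_isIrreducible hirr snh θ) (w := 1) (fun _ => one_pos)
      fun y => ?_
    simp only [mulVec, dotProduct, Pi.one_apply, mul_one]
    refine (Finset.sum_le_sum fun y' _ => hk y y').trans_eq ?_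
    simp
  have h4 := Real.log_le_log (pfEigenvalue_pos (kMatrix_isIrreducible hirr snh θ)) h3
  rw [Real.log_mul (by positivity) (by positivity), Real.log_rpow hX] at h4
  have h5 := mul_le_mul_of_nonneg_left h4 h0.le
  have h6 : (1 + θ) * (Real.log (Fintype.card Y) + 1 / (1 + θ) * Real.log (Fintype.card X)) =
      (1 + θ) * Real.log (Fintype.card Y) + Real.log (Fintype.card X) := by field_simp
  have h7 := Real.log_nonneg hY
  nlinarith

lemma tendsto_upperEntropy_neg_one (hW : W ∈ Matrix.colStochastic ℝ (X × Y))
    (hirr : W.IsIrreducible) (snh : StronglyNonHidden W)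
    (h0 : Tendsto (upperEntropy W) (𝓝[≠] 0) (𝓝 (upperEntropy W 0))) :
    Tendsto (upperEntropy W) (𝓝[>] (-1)) (𝓝 (upperEntropy W (-1))) := by
  obtain ⟨L, hL⟩ := exists_tendsto_nhdsGT_neg_one (convexOn_log_kMatrix hirr snh)
    (mul_upperEntropy hW hirr snh) h0 (fun θ => log_kMatrix_le hW hirr snh)
  have hL' : Tendsto (fun t => -((1 + t) / t) * Real.log (pfEigenvalue (kMatrix W t))) (𝓝[>] (-1))
      (𝓝 L) := by
    refine hL.congr' ?_
    filter_upwards [self_mem_nhdsWithin, eventually_ne_zero_nhdsGT] with t ht ht'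
    rw [upperEntropy_of_ne ht' (ne_of_gt ht)]
  have : upperEntropy W (-1) = L := by
    simp only [upperEntropy, if_true]
    rw [if_neg (by norm_num)]
    exact hL'.limUnder_eq
  rwa [this]

/-- Rewrites the additive term of the two-parameter entropy as a log-eigenvalue, including at `θ =
0`, where the upper entropy is only a limit. -/
lemma div_mul_upperEntropy (hW : W ∈ Matrix.colStochastic ℝ (X × Y)) (hirr : W.IsIrreducible)
    (snh : StronglyNonHidden W) {θ : ℝ} (hθ : -1 < θ) :
    θ / (1 + θ) * upperEntropy W θ = -Real.log (pfEigenvalue (kMatrix W θ)) := by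
  have h0 : 1 + θ ≠ 0 := by linarith
  rw [div_mul_eq_mul_div, mul_upperEntropy hW hirr snh θ hθ]
  field_simp

lemma twoParamEntropy_of_ne (hW : W ∈ Matrix.colStochastic ℝ (X × Y)) (hirr : W.IsIrreducible)
    (snh : StronglyNonHidden W) {θ θ' : ℝ} (h0 : θ ≠ 0) (hθ' : -1 < θ') :
    twoParamEntropy W θ θ' = -(1 / θ) * Real.log (pfEigenvalue (nMatrix W θ θ')) -
      Real.log (pfEigenvalue (kMatrix W θ')) := by
  simp only [twoParamEntropy, h0, if_false]
  rw [div_mul_upperEntropy hW hirr snh hθ']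
  ring

lemma mul_twoParamEntropy (hW : W ∈ Matrix.colStochastic ℝ (X × Y)) (hirr : W.IsIrreducible)
    (snh : StronglyNonHidden W) {θ' : ℝ} (hθ' : -1 < θ') (θ : ℝ) :
    θ * twoParamEntropy W θ θ' = -(Real.log (pfEigenvalue (nMatrix W θ θ')) +
      θ * Real.log (pfEigenvalue (kMatrix W θ'))) := by
  rcases eq_or_ne θ 0 with rfl | h0
  · rw [log_pfEigenvalue_nMatrix_zero hW hirr snh]
    simp
  · rw [twoParamEntropy_of_ne hW hirr snh h0 hθ']
    field_simp
    ring

lemma tendsto_twoParamEntropy_zero (hW : W ∈ Matrix.colStochastic ℝ (X × Y))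
    (hirr : W.IsIrreducible) (snh : StronglyNonHidden W) {θ' d : ℝ} (hθ' : -1 < θ')
    (hd : HasDerivAt (fun t => Real.log (pfEigenvalue (nMatrix W t θ'))) d 0) :
    twoParamEntropy W 0 θ' = -d - Real.log (pfEigenvalue (kMatrix W θ')) ∧
      Tendsto (fun θ => twoParamEntropy W θ θ') (𝓝[≠] 0)
        (𝓝 (-d - Real.log (pfEigenvalue (kMatrix W θ')))) := by
  have h1 := (tendsto_neg_div_of_hasDerivAt (log_pfEigenvalue_nMatrix_zero hW hirr snh θ')
    hd).sub_const (Real.log (pfEigenvalue (kMatrix W θ')))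
  refine ⟨?_, h1.congr' ?_⟩
  · simp only [twoParamEntropy, if_true]
    refine Tendsto.limUnder_eq (h1.congr fun t => ?_)
    rw [div_mul_upperEntropy hW hirr snh hθ']
    ring
  · filter_upwards [self_mem_nhdsWithin] with t ht
    rw [twoParamEntropy_of_ne hW hirr snh ht hθ']

lemma exists_hasDerivAt_nMatrix (hirr : W.IsIrreducible) (snh : StronglyNonHidden W) (θ' : ℝ) :
    ∃ d, HasDerivAt (fun t => Real.log (pfEigenvalue (nMatrix W t θ'))) d 0 :=
  ⟨_, (differentiableAt_log_pfEigenvalue (fun t => nMatrix_isIrreducible hirr snh t θ')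
    (differentiableAt_nMatrix_left hirr.nonneg (by norm_num) θ')).hasDerivAt⟩

lemma twoParamEntropy_zero_right (hW : W ∈ Matrix.colStochastic ℝ (X × Y))
    (hirr : W.IsIrreducible) (snh : StronglyNonHidden W) {θ : ℝ} (hθ : -1 < θ) :
    twoParamEntropy W θ 0 = lowerEntropy W θ := by
  rcases eq_or_ne θ 0 with rfl | h0
  · obtain ⟨d, hd⟩ := exists_hasDerivAt_nMatrix hirr snh (0 : ℝ)
    rw [(tendsto_twoParamEntropy_zero hW hirr snh (by norm_num) hd).1,
      log_pfEigenvalue_kMatrix_zero hW hirr snh, sub_zero]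
    refine (tendsto_lowerEntropy_zero hW hirr snh.nonHidden
      (hd.congr_of_eventuallyEq ?_)).1.symm
    filter_upwards [eventually_gt_neg_one] with t ht
    rw [pfEigenvalue_tilted_eq hirr snh ht]
  · rw [twoParamEntropy_of_ne hW hirr snh h0 (by norm_num), lowerEntropy_of_ne h0 hθ.ne',
      pfEigenvalue_tilted_eq hirr snh hθ, log_pfEigenvalue_kMatrix_zero hW hirr snh, sub_zero]

lemma twoParamEntropy_self (hW : W ∈ Matrix.colStochastic ℝ (X × Y))
    (hirr : W.IsIrreducible) (snh : StronglyNonHidden W) {θ : ℝ} (hθ : -1 < θ) :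
    twoParamEntropy W θ θ = upperEntropy W θ := by
  rcases eq_or_ne θ 0 with rfl | h0
  -- At `0` the two sides are limits of different functions; they agree because the underlying
  -- derivatives do.
  · obtain ⟨d, hd, hd'⟩ := exists_hasDerivAt_nMatrix_kMatrix hW hirr snh
    rw [(tendsto_twoParamEntropy_zero hW hirr snh (by norm_num) hd).1,
      (tendsto_upperEntropy_zero hW hirr snh hd').1, log_pfEigenvalue_kMatrix_zero hW hirr snh,
      sub_zero]
  · rw [twoParamEntropy_of_ne hW hirr snh h0 hθ, nMatrix_self hirr.nonneg hθ,
      upperEntropy_of_ne h0 hθ.ne']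
    field_simp
    ring

/-- The two-parameter entropy is maximal on the diagonal. -/
lemma twoParamEntropy_le_upperEntropy (hW : W ∈ Matrix.colStochastic ℝ (X × Y))
    (hirr : W.IsIrreducible) (snh : StronglyNonHidden W) {θ θ' : ℝ} (hθ : -1 < θ) (h0 : θ ≠ 0)
    (hθ' : -1 < θ') : twoParamEntropy W θ θ' ≤ upperEntropy W θ := by
  have hW0 := hirr.nonneg
  have i₁ : 0 < 1 + θ := by linarith
  have i₂ : 0 < 1 + θ' := by linarith
  have hN := nMatrix_isIrreducible hirr snh θ θ'
  have hK := kMatrix_isIrreducible hirr snh θ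
  have hK' := kMatrix_isIrreducible hirr snh θ'
  rw [twoParamEntropy_of_ne hW hirr snh h0 hθ', upperEntropy_of_ne h0 hθ.ne']
  rcases lt_or_gt_of_ne h0 with hneg | hpos
  -- For `θ < 0` the matrix `N` is the geometric mean of `K_θ` and `K_θ'` with positive weights `1 +
  -- θ` and `-θ`.
  · have := log_pfEigenvalue_le hK hK' hN i₁ (by linarith : 0 < -θ) (by ring) fun y y' => by
      rcases eq_or_lt_of_le (marginal_nonneg hW0 y y') with h | h
      · rw [nMatrix_eq_zero hW0 hθ θ' h.symm, kMatrix_eq_zero hW0 hθ h.symm,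
          Real.zero_rpow i₁.ne', zero_mul]
      · rw [nMatrix_eq_exp_log hW0 _ _ h, kMatrix_eq_exp hW0 _ h, kMatrix_eq_exp hW0 _ h,
          ← Real.exp_mul, ← Real.exp_mul, ← Real.exp_add]
        refine le_of_eq ?_
        congr 1
        field_simp
        ring
    have h1 := mul_le_mul_of_nonneg_left this (one_div_pos.2 (by linarith : 0 < -θ)).le
    have e1 : 1 / -θ = -(1 / θ) := by rw [div_neg]
    rw [e1] at h1
    have e2 : -(1 / θ) * ((1 + θ) * Real.log (pfEigenvalue (kMatrix W θ)) +
        -θ * Real.log (pfEigenvalue (kMatrix W θ'))) =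
        -((1 + θ) / θ) * Real.log (pfEigenvalue (kMatrix W θ)) +
          Real.log (pfEigenvalue (kMatrix W θ')) := by
      field_simp
      ring
    rw [e2] at h1
    linarith
  -- For `θ > 0` the weight `-θ` is negative, so the identity is solved for `K_θ`, with weights `1 /
  -- (1 + θ)` and `θ / (1 + θ)`.
  · have := log_pfEigenvalue_le hN hK' hK (one_div_pos.2 i₁) (div_pos hpos i₁)
      (by field_simp) fun y y' => by
      rcases eq_or_lt_of_le (marginal_nonneg hW0 y y') with h | h
      · rw [nMatrix_eq_zero hW0 hθ θ' h.symm, kMatrix_eq_zero hW0 hθ h.symm,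
          Real.zero_rpow (one_div_pos.2 i₁).ne', zero_mul]
      · rw [nMatrix_eq_exp_log hW0 _ _ h, kMatrix_eq_exp hW0 _ h, kMatrix_eq_exp hW0 _ h,
          ← Real.exp_mul, ← Real.exp_mul, ← Real.exp_add]
        refine le_of_eq ?_
        congr 1
        field_simp
        ring
    have h1 := mul_le_mul_of_nonneg_left this (div_pos i₁ hpos).le
    have e2 : (1 + θ) / θ * (1 / (1 + θ) * Real.log (pfEigenvalue (nMatrix W θ θ')) +
        θ / (1 + θ) * Real.log (pfEigenvalue (kMatrix W θ'))) =
        1 / θ * Real.log (pfEigenvalue (nMatrix W θ θ')) +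
          Real.log (pfEigenvalue (kMatrix W θ')) := by
      field_simp
    rw [e2] at h1
    linarith

lemma isMaxOn_twoParamEntropy (hW : W ∈ Matrix.colStochastic ℝ (X × Y))
    (hirr : W.IsIrreducible) (snh : StronglyNonHidden W) {θ : ℝ} (hθ : -1 < θ) (h0 : θ ≠ 0) :
    IsMaxOn (fun θ' => twoParamEntropy W θ θ') (Ioi (-1)) θ := fun θ' hθ' => by
  change twoParamEntropy W θ θ' ≤ twoParamEntropy W θ θ
  rw [twoParamEntropy_self hW hirr snh hθ]
  exact twoParamEntropy_le_upperEntropy hW hirr snh hθ h0 hθ'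

/-- Fermat's rule at the interior maximum; only differentiability has to be established, and it
comes from perturbation theory. -/
lemma hasDerivAt_twoParamEntropy (hW : W ∈ Matrix.colStochastic ℝ (X × Y))
    (hirr : W.IsIrreducible) (snh : StronglyNonHidden W) {θ : ℝ} (hθ : -1 < θ) (h0 : θ ≠ 0) :
    HasDerivAt (fun θ' => twoParamEntropy W θ θ') 0 θ := by
  have hmem : Ioi (-1) ∈ 𝓝 θ := isOpen_Ioi.mem_nhds (mem_Ioi.2 hθ)
  have hd : DifferentiableAt ℝ (fun θ' => twoParamEntropy W θ θ') θ := by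
    have h1 := differentiableAt_log_pfEigenvalue (fun t => nMatrix_isIrreducible hirr snh θ t)
      (differentiableAt_nMatrix_right hirr.nonneg hθ hθ)
    have h2 := differentiableAt_log_pfEigenvalue (fun t => kMatrix_isIrreducible hirr snh t)
      (differentiableAt_kMatrix hirr.nonneg hθ)
    refine ((h1.const_mul (-(1 / θ))).fun_sub h2).congr_of_eventuallyEq ?_
    filter_upwards [hmem] with t ht
    exact twoParamEntropy_of_ne hW hirr snh h0 ht
  have hmax := (isMaxOn_twoParamEntropy hW hirr snh hθ h0).isLocalMax hmem
  have := hd.hasDerivAt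
  rwa [hmax.deriv_eq_zero] at this

end Upper

end MarkovRenyi

/-! ### Assembly of the main theorem -/

theorem mainTheorem7 {X Y : Type*} [Fintype X] [DecidableEq X] [Nonempty X]
    [Fintype Y] [DecidableEq Y] [Nonempty Y]
    (W : Matrix (X × Y) (X × Y) ℝ) (hW : W ∈ Matrix.colStochastic ℝ (X × Y))
    (hirr : W.IsIrreducible) (herg : MarkovRenyi.IsErgodic W) :
    (MarkovRenyi.NonHidden W →
      -- the limits that define the lower entropy at `θ = 0, -1` and the variance exist
      Tendsto (MarkovRenyi.lowerEntropy W) (𝓝[≠] 0) (𝓝 (MarkovRenyi.condEntropy W)) ∧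
      Tendsto (MarkovRenyi.lowerEntropy W) (𝓝[>] (-1)) (𝓝 (MarkovRenyi.lowerEntropy W (-1))) ∧
      Tendsto (MarkovRenyi.varianceQuotient W) (𝓝[≠] 0) (𝓝 (MarkovRenyi.condVariance W)) ∧
      -- lower entropy: concavity and monotonicity
      ConcaveOn ℝ (Ici (-1)) (fun θ => θ * MarkovRenyi.lowerEntropy W θ) ∧
      (StrictConcaveOn ℝ (Ici (-1)) (fun θ => θ * MarkovRenyi.lowerEntropy W θ) ↔
        0 < MarkovRenyi.condVariance W) ∧
      AntitoneOn (MarkovRenyi.lowerEntropy W) (Ici (-1)) ∧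
      (StrictAntiOn (MarkovRenyi.lowerEntropy W) (Ici (-1)) ↔
        0 < MarkovRenyi.condVariance W)) ∧
    (MarkovRenyi.StronglyNonHidden W →
      -- the limits that define the upper entropy at `θ = 0, -1` and the two-parameter one at
      -- `θ = 0` exist
      Tendsto (MarkovRenyi.upperEntropy W) (𝓝[≠] 0) (𝓝 (MarkovRenyi.upperEntropy W 0)) ∧
      Tendsto (MarkovRenyi.upperEntropy W) (𝓝[>] (-1)) (𝓝 (MarkovRenyi.upperEntropy W (-1))) ∧
      (∀ θ' : ℝ, -1 < θ' →
        Tendsto (fun θ => MarkovRenyi.twoParamEntropy W θ θ') (𝓝[≠] 0)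
          (𝓝 (MarkovRenyi.twoParamEntropy W 0 θ'))) ∧
      -- upper entropy: concavity and monotonicity
      ConcaveOn ℝ (Ici (-1)) (fun θ => θ * MarkovRenyi.upperEntropy W θ) ∧
      (StrictConcaveOn ℝ (Ici (-1)) (fun θ => θ * MarkovRenyi.upperEntropy W θ) ↔
        0 < MarkovRenyi.condVariance W) ∧
      AntitoneOn (MarkovRenyi.upperEntropy W) (Ici (-1)) ∧
      (StrictAntiOn (MarkovRenyi.upperEntropy W) (Ici (-1)) ↔
        0 < MarkovRenyi.condVariance W) ∧
      -- comparison
      (∀ θ : ℝ, -1 < θ → θ ≠ 0 →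
        MarkovRenyi.lowerEntropy W θ ≤ MarkovRenyi.upperEntropy W θ) ∧
      -- two-parameter entropy: concavity and monotonicity in the first parameter
      (∀ θ' : ℝ, -1 < θ' →
        ConcaveOn ℝ (Ioi (-1)) (fun θ => θ * MarkovRenyi.twoParamEntropy W θ θ') ∧
        (StrictConcaveOn ℝ (Ioi (-1)) (fun θ => θ * MarkovRenyi.twoParamEntropy W θ θ') ↔
          0 < MarkovRenyi.condVariance W) ∧
        AntitoneOn (fun θ => MarkovRenyi.twoParamEntropy W θ θ') (Ioi (-1)) ∧
        (StrictAntiOn (fun θ => MarkovRenyi.twoParamEntropy W θ θ') (Ioi (-1)) ↔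
          0 < MarkovRenyi.condVariance W)) ∧
      -- special cases
      (∀ θ : ℝ, -1 < θ →
        MarkovRenyi.twoParamEntropy W θ 0 = MarkovRenyi.lowerEntropy W θ) ∧
      (∀ θ : ℝ, -1 < θ →
        MarkovRenyi.twoParamEntropy W θ θ = MarkovRenyi.upperEntropy W θ) ∧
      -- maximization over the second parameter
      (∀ θ : ℝ, -1 < θ → θ ≠ 0 →
        IsMaxOn (fun θ' => MarkovRenyi.twoParamEntropy W θ θ') (Ioi (-1)) θ ∧
        HasDerivAt (fun θ' => MarkovRenyi.twoParamEntropy W θ θ') 0 θ)) := by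
  refine ⟨fun nh => ?_, fun snh => ?_⟩
  · obtain ⟨m, -, -, hm, -, -⟩ := MarkovRenyi.exists_expansion_tilted hW hirr nh
    obtain ⟨e0, t0⟩ := MarkovRenyi.tendsto_lowerEntropy_zero hW hirr nh hm
    rw [← e0] at t0
    have t1 := MarkovRenyi.tendsto_lowerEntropy_neg_one hW hirr nh t0
    obtain ⟨tV, hV⟩ := MarkovRenyi.condVariance_spec hW hirr nh
    exact ⟨t0, t1, tV, MarkovRenyi.concave_antitone_Ici (MarkovRenyi.convexOn_log_tilted hirr nh)
      (MarkovRenyi.mul_lowerEntropy hW hirr nh) t0 t1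
      (fun hp => MarkovRenyi.strictConvexOn_log_tilted hirr nh (hV.1 hp))
      fun hp => MarkovRenyi.log_tilted_eq_of_isCoboundary hW hirr nh (not_not.1 (mt hV.2 hp))⟩
  · have hV := (MarkovRenyi.condVariance_spec hW hirr snh.nonHidden).2
    have hstrict : 0 < MarkovRenyi.condVariance W → ¬MarkovRenyi.IsMarginalCoboundary W :=
      fun hp h => hV.1 hp h.isCoboundary
    have hcob : ¬0 < MarkovRenyi.condVariance W → MarkovRenyi.IsMarginalCoboundary W :=
      fun hp => (not_not.1 (mt hV.2 hp)).isMarginalCoboundary hW hirr snh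
    obtain ⟨d, -, hd⟩ := MarkovRenyi.exists_hasDerivAt_nMatrix_kMatrix hW hirr snh
    obtain ⟨e0, t0⟩ := MarkovRenyi.tendsto_upperEntropy_zero hW hirr snh hd
    rw [← e0] at t0
    have t1 := MarkovRenyi.tendsto_upperEntropy_neg_one hW hirr snh t0
    have tN : ∀ θ' : ℝ, -1 < θ' → Tendsto (fun θ => MarkovRenyi.twoParamEntropy W θ θ') (𝓝[≠] 0)
        (𝓝 (MarkovRenyi.twoParamEntropy W 0 θ')) := fun θ' hθ' => by
      obtain ⟨d', hd'⟩ := MarkovRenyi.exists_hasDerivAt_nMatrix hirr snh θ'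
      obtain ⟨e, t⟩ := MarkovRenyi.tendsto_twoParamEntropy_zero hW hirr snh hθ' hd'
      rwa [e]
    obtain ⟨u1, u2, u3, u4⟩ := MarkovRenyi.concave_antitone_Ici
      (MarkovRenyi.convexOn_log_kMatrix hirr snh) (MarkovRenyi.mul_upperEntropy hW hirr snh) t0 t1
      (fun hp => MarkovRenyi.strictConvexOn_log_kMatrix hirr snh (hstrict hp)) fun hp => by
        obtain ⟨c, g, hg⟩ := hcob hp
        refine ⟨c, fun θ hθ => ?_⟩
        have h1 : 1 + θ ≠ 0 := by linarith
        rw [MarkovRenyi.log_pfEigenvalue_of_gauge hW hirr snh.nonHidden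
          (MarkovRenyi.kMatrix_isIrreducible hirr snh θ)
          (MarkovRenyi.kMatrix_of_hasPotential hirr.nonneg hg hθ)]
        field_simp
    refine ⟨t0, t1, tN, u1, u2, u3, u4, fun θ hθ h0 => ?_, fun θ' hθ' => ?_,
      fun θ hθ => MarkovRenyi.twoParamEntropy_zero_right hW hirr snh hθ,
      fun θ hθ => MarkovRenyi.twoParamEntropy_self hW hirr snh hθ,
      fun θ hθ h0 => ⟨MarkovRenyi.isMaxOn_twoParamEntropy hW hirr snh hθ h0,
        MarkovRenyi.hasDerivAt_twoParamEntropy hW hirr snh hθ h0⟩⟩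
    · rw [← MarkovRenyi.twoParamEntropy_zero_right hW hirr snh hθ]
      exact MarkovRenyi.twoParamEntropy_le_upperEntropy hW hirr snh hθ h0 (by norm_num)
    -- For fixed `θ'` the term with `K_θ'` is linear in `θ`, so it affects neither convexity nor
    -- strictness.
    · have hlin := LinearMap.convexOn
        (LinearMap.mulRight ℝ (Real.log (MarkovRenyi.pfEigenvalue (MarkovRenyi.kMatrix W θ'))))
        (convex_Ioi (-1 : ℝ))
      refine MarkovRenyi.concave_antitone_Ioi
        ((MarkovRenyi.convexOn_log_nMatrix hirr snh θ').add hlin)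
        (fun θ _ => MarkovRenyi.mul_twoParamEntropy hW hirr snh hθ' θ) (tN θ' hθ')
        (fun hp => (MarkovRenyi.strictConvexOn_log_nMatrix hirr snh hθ' (hstrict hp)).add_convexOn
          hlin) fun hp => ?_
      obtain ⟨c, g, hg⟩ := hcob hp
      refine ⟨c, fun θ hθ => ?_⟩
      have h1 : 1 + θ' ≠ 0 := by linarith
      simp only [Pi.add_apply, LinearMap.mulRight_apply]
      rw [MarkovRenyi.log_pfEigenvalue_of_gauge hW hirr snh.nonHidden
          (MarkovRenyi.nMatrix_isIrreducible hirr snh θ θ')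
          (MarkovRenyi.nMatrix_of_hasPotential hirr.nonneg hg hθ hθ'),
        MarkovRenyi.log_pfEigenvalue_of_gauge hW hirr snh.nonHidden
          (MarkovRenyi.kMatrix_isIrreducible hirr snh θ')
          (MarkovRenyi.kMatrix_of_hasPotential hirr.nonneg hg hθ')]
      -- The slopes `θ / (1 + θ')` from `N` and `θ * θ' / (1 + θ')` from `K_θ'` add up to `θ`.
      field_simp
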